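/- Write $\hat f(\xi)=(2\pi)^{-5/2}\int_{\mathbb{R}^5}e^{-ix\cdot\xi}f(x)\,dx$ (extended to $L^2(\mathbb{R}^5)$ by Plancherel), and let $e^{it\Delta^2}$ be the Fourier multiplier on $L^2(\mathbb{R}^5)$ with symbol $e^{it|\xi|^4}$. For $x\in\mathbb{R}^5$ and $t>0$ put $$\xi_*=\xi_*(x,t)=-\Big(\frac{|x|}{4t}\Big)^{1/3}\frac{x}{|x|}\quad(x\neq 0),\qquad \xi_*(0,t)=0 .$$ There are a constant $C$ and a function $\rho:\mathbb{R}^5\times(0,\infty)\to\mathbb{C}$ with $$\sup_{x\in\mathbb{R}^5}|\rho(x,t)|\le C\,t^{-5/4}\qquad\text{for all } t>0,$$ such that for every $f\in L^2(\mathbb{R}^5)$ with $\hat f\in H^3(\mathbb{R}^5)$ the following holds: $\hat f$ has a continuous representative and, for every $t>0$, so does $e^{it\Delta^2}f$, and these representatives satisfy $$\big|e^{it\Delta^2}f(x)-\rho(x,t)\,\hat f(\xi_*(x,t))\big|\le C\,t^{-11/8}\,\|\hat f\|_{H^3}\qquad\text{for all } x\in\mathbb{R}^5,\ t>0 .$$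 Moreover $$\|e^{it\Delta^2}f\|_{L^\infty}\le C\,\big(t^{-5/4}\,\|\hat f\|_{L^\infty}+t^{-11/8}\,\|\hat f\|_{H^3}\big)\qquad\text{for all } t>0 .$$ -/

import Mathlib

open MeasureTheory FourierTransform TemperedDistribution
open scoped ENNReal SchwartzMap

noncomputable section

/-- Five-dimensional Euclidean space. -/
abbrev E5 : Type := EuclideanSpace ℝ (Fin 5)

/-- `L²(ℝ⁵; ℂ)`. -/
abbrev L2E5 : Type := Lp (α := E5) ℂ 2

/-- Square integrability survives a dilation followed by multiplication by a constant. -/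
theorem memLp_dilate (F : L2E5) (c : ℂ) :
    MemLp (fun ξ : E5 ↦ c * F ((2 * Real.pi)⁻¹ • ξ)) 2 volume := by
  have hr : ((2 * Real.pi)⁻¹ : ℝ) ≠ 0 := by positivity
  have hm := Measure.map_addHaar_smul (volume : Measure E5) hr
  have h1 : MemLp F 2 (Measure.map (fun ξ : E5 ↦ (2 * Real.pi)⁻¹ • ξ) volume) := by
    have h2 := (Lp.memLp F).smul_measure (c := ENNReal.ofReal
      |(((2 * Real.pi)⁻¹ : ℝ) ^ Module.finrank ℝ E5)⁻¹|) ENNReal.ofReal_ne_top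
    rw [← hm] at h2
    exact h2
  have h3 := (memLp_map_measure_iff h1.1
    (measurable_const_smul ((2 * Real.pi)⁻¹ : ℝ)).aemeasurable).1 h1
  exact h3.const_mul c

/-- The Fourier transform on `L²(ℝ⁵)` in the unitary angular-frequency normalization, i.e. the
extension to `L²` of `f ↦ (2π)^(-5/2) ∫ e^(-i x·ξ) f(x) dx`. It is expressed through
Mathlib's Plancherel transform `𝓕`, the extension of `f ↦ ∫ e^(-2πi x·ξ) f(x) dx`. -/
def hat (f : L2E5) : L2E5 :=
  (memLp_dilate (𝓕 f) (((2 * Real.pi) ^ (-(5 / 2 : ℝ)) : ℝ) : ℂ)).toLp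

/-- The Fourier symbol of `e^{itΔ²}` at the frequency `η` of Mathlib's Fourier transform, which
corresponds to the angular frequency `ξ = 2πη`: it is `e^{it|ξ|⁴}`. -/
def propagatorSymbol (t : ℝ) (η : E5) : ℂ :=
  Complex.exp (Complex.I * ((t * (2 * Real.pi * ‖η‖) ^ 4 : ℝ) : ℂ))

theorem memLp_propagatorSymbol_mul (t : ℝ) (F : L2E5) :
    MemLp (fun η : E5 ↦ propagatorSymbol t η * F η) 2 volume := by
  have hc : Continuous (propagatorSymbol t) := by
    unfold propagatorSymbol
    fun_prop
  refine (Lp.memLp F).of_le (hc.aestronglyMeasurable.mul (Lp.aestronglyMeasurable F)) ?_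
  filter_upwards with η
  rw [norm_mul, propagatorSymbol, mul_comm Complex.I, Complex.norm_exp_ofReal_mul_I, one_mul]

/-- The free fourth-order Schrödinger group `e^{itΔ²}` on `L²(ℝ⁵)`: the Fourier multiplier
with symbol `e^{it|ξ|⁴}`. -/
def propagator (t : ℝ) (f : L2E5) : L2E5 :=
  𝓕⁻ ((memLp_propagatorSymbol_mul t (𝓕 f)).toLp : L2E5)

/-- The norm of the Sobolev space `H^s(ℝ⁵) = H^{s,2}(ℝ⁵)`: the `L²` norm of the function that
represents the Bessel potential `⟨D⟩^s h`, which is unique. -/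
def sobolevNorm (s : ℝ) (h : 𝓢'(E5, ℂ)) (hh : MemSobolev s 2 h) : ℝ :=
  ‖hh.choose‖

theorem sobolevNorm_eq (s : ℝ) (h : 𝓢'(E5, ℂ)) (hh : MemSobolev s 2 h) (g : L2E5)
    (hg : besselPotential E5 ℂ s h = (g : 𝓢'(E5, ℂ))) : sobolevNorm s h hh = ‖g‖ := by
  have h1 : (hh.choose : 𝓢'(E5, ℂ)) = (g : 𝓢'(E5, ℂ)) := hh.choose_spec.symm.trans hg
  have h2 : hh.choose = g :=
    LinearMap.ker_eq_bot.1 (Lp.ker_toTemperedDistributionCLM_eq_bot (F := ℂ)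
      (μ := (volume : Measure E5)) (p := 2)) h1
  rw [sobolevNorm, h2]

/-- The critical point `ξ_* = (-|x| / (4t))^{1/3} x / |x|` of `ξ ↦ |ξ|⁴ + ξ·x / t`, with the real
cube root of the negative number written as `-(|x| / (4t))^{1/3}`; it is `0` at `x = 0`. -/
def xiStar (x : E5) (t : ℝ) : E5 :=
  (-(‖x‖ / (4 * t)) ^ (1 / 3 : ℝ)) • (‖x‖⁻¹ • x)

end

/-! The solution is a convolution, `e^{itΔ²}f(x) = (2π)^{-5} ∫ K_t(x-z) f(z) dz` with `K_t(x) =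
t^{-5/4} K(t^{-1/4}x)`. The coefficient is `ρ(x,t) = (2π)^{-5/2} K_t(x)` itself, so no asymptotic
expansion of the kernel is needed. The error is then `(2π)^{-5} ∫ (K_t(x-z) - K_t(x) e^{-iz·ξ_*})
f(z) dz`, and everything rests on three properties of `K`: it is bounded, it is Lipschitz, and
`|y|^{1/3} |K(y)|` is bounded. With `y = t^{-1/4}x`, the Lipschitz bound controls `K_t(x-z) -
K_t(x)`. Since `|ξ_*| ≤ |y|^{1/3} t^{-1/4}`, the decay controls `K_t(x)(e^{-iz·ξ_*} - 1)`. The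
bracket is thus `O(t^{-5/4} min(1, t^{-1/4}|z|))` (`norm_scaledKernel_sub_le`).

The hypothesis `f̂ ∈ H³` says that `f` is an `L²` function divided by a cubic weight. In dimension
five Cauchy-Schwarz gives `∫ min(1, τ|z|) |f| ≤ C τ^{1/2} ‖f̂‖_{H³}` (`exists_weighted_L1_bound`),
and `τ = t^{-1/4}` supplies the extra `t^{-1/8}`.

For the properties of `K`, replace the symbol by `e^{-a|ξ|⁴}` with `Re a > 0` and `|a| ≥ 1`.
Integration over spheres leaves `∫ s⁴ Ψ(|y|s) e^{-as⁴} ds`, where `Ψ` is the Fourier integral of `1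
- u²` on `[-1,1]`. Because `1 - u²` vanishes at the endpoints, `Ψ` and its derivatives decay
quadratically, and two integrations by parts against `e^{-as⁴}` give bounds independent of `Re a`
(`quarticKernel_bounds`). A limit `a = ε - i`, `ε → 0`, along a subsequence produces `K`. -/

/-! ### Oscillatory integrals with polynomial density. -/

/-- The oscillatory integral `∫_{-1}^{1} p(u) e^{ixu} du` with a polynomial density. -/
noncomputable def oscPoly (p : Polynomial ℂ) (x : ℝ) : ℂ :=
  ∫ u in (-1 : ℝ)..1, p.eval (u : ℂ) * Complex.exp (Complex.I * ((x * u : ℝ) : ℂ))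

theorem norm_exp_I_mul_ofReal (x : ℝ) : ‖Complex.exp (Complex.I * (x : ℂ))‖ = 1 := by
  rw [mul_comm, Complex.norm_exp_ofReal_mul_I]

theorem oscPoly_bounded (p : Polynomial ℂ) : ∃ C : ℝ, 0 ≤ C ∧ ∀ x, ‖oscPoly p x‖ ≤ C := by
  have hc : Continuous fun u : ℝ ↦ p.eval (u : ℂ) := by fun_prop
  obtain ⟨C, hC⟩ := isCompact_Icc.exists_bound_of_continuousOn (s := Set.Icc (-1 : ℝ) 1)
    hc.continuousOn
  have hC0 : 0 ≤ C := (norm_nonneg _).trans (hC 0 (by simp))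
  refine ⟨C * |1 - (-1 : ℝ)|, by positivity, fun x ↦ ?_⟩
  refine intervalIntegral.norm_integral_le_of_norm_le_const fun u hu ↦ ?_
  rw [norm_mul, norm_exp_I_mul_ofReal, mul_one]
  rw [Set.uIoc_of_le (by norm_num)] at hu
  exact hC u ⟨hu.1.le, hu.2⟩

/-- Two integrations by parts. The zeros of `p` at `±1` remove the boundary terms of order `1/x`;
those containing `p'` are already of order `x⁻²`. -/
theorem oscPoly_second_order (p : Polynomial ℂ) (h1 : p.eval 1 = 0) (h2 : p.eval (-1) = 0) :
    ∃ C : ℝ, 0 ≤ C ∧ ∀ x : ℝ, x ^ 2 * ‖oscPoly p x‖ ≤ C := by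
  obtain ⟨C, hC0, hC⟩ := oscPoly_bounded (p.derivative.derivative)
  refine ⟨C + ‖p.derivative.eval 1‖ + ‖p.derivative.eval (-1)‖, by positivity, fun x ↦ ?_⟩
  set e : ℝ → ℂ := fun u ↦ Complex.exp (Complex.I * ((x * u : ℝ) : ℂ)) with he
  have hed : ∀ u : ℝ, HasDerivAt e (e u * (Complex.I * x)) u := by
    intro u
    have := (((hasDerivAt_id u).const_mul x).ofReal_comp.const_mul Complex.I).cexp
    simpa [he] using this
  have hpd : ∀ (q : Polynomial ℂ) (u : ℝ), HasDerivAt (fun u : ℝ ↦ q.eval (u : ℂ))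
      (q.derivative.eval (u : ℂ)) u := fun q u ↦ (q.hasDerivAt (u : ℂ)).comp_ofReal
  have hd : ∀ u ∈ Set.uIcc (-1 : ℝ) 1, HasDerivAt
      (fun u : ℝ ↦ e u * (Complex.I * x * p.eval (u : ℂ) - p.derivative.eval (u : ℂ)))
      (-(x : ℂ) ^ 2 * (p.eval (u : ℂ) * e u) - p.derivative.derivative.eval (u : ℂ) * e u) u := by
    intro u _
    refine ((hed u).mul (((hpd p u).const_mul (Complex.I * x)).sub
      (hpd p.derivative u))).congr_deriv ?_
    simp only [Pi.sub_apply]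
    linear_combination (p.eval (u : ℂ) * e u * x ^ 2) * Complex.I_sq
  have hec : Continuous e := by
    simp only [he]; fun_prop
  have hi : ∀ q : Polynomial ℂ, IntervalIntegrable (fun u : ℝ ↦ q.eval (u : ℂ) * e u)
      volume (-1) 1 := fun q ↦ Continuous.intervalIntegrable (by fun_prop) _ _
  have hint := intervalIntegral.integral_eq_sub_of_hasDerivAt hd
    (((hi p).const_mul _).sub (hi _))
  rw [intervalIntegral.integral_sub ((hi p).const_mul _) (hi _),
    intervalIntegral.integral_const_mul] at hint
  change -(x : ℂ) ^ 2 * oscPoly p x - oscPoly p.derivative.derivative x = _ at hint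
  have h3 : (x : ℂ) ^ 2 * oscPoly p x = - oscPoly p.derivative.derivative x
      + e 1 * p.derivative.eval 1 - e (-1) * p.derivative.eval (-1) := by
    have : ((-1 : ℝ) : ℂ) = -1 := by simp
    rw [this, Complex.ofReal_one, h1, h2] at hint
    linear_combination -hint
  have h4 : x ^ 2 * ‖oscPoly p x‖ = ‖(x : ℂ) ^ 2 * oscPoly p x‖ := by
    rw [norm_mul, norm_pow, Complex.norm_real, Real.norm_eq_abs, sq_abs]
  have he1 : ∀ u, ‖e u‖ = 1 := fun u ↦ norm_exp_I_mul_ofReal _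
  rw [h4, h3]
  refine (norm_sub_le _ _).trans (add_le_add ((norm_add_le _ _).trans (add_le_add ?_ ?_)) ?_)
  · rw [norm_neg]; exact hC x
  · rw [norm_mul, he1, one_mul]
  · rw [norm_mul, he1, one_mul]

theorem oscPoly_decay (p : Polynomial ℂ) (h1 : p.eval 1 = 0) (h2 : p.eval (-1) = 0) :
    ∃ C : ℝ, 0 ≤ C ∧ ∀ x : ℝ, 0 ≤ x → (1 + x) ^ 2 * ‖oscPoly p x‖ ≤ C := by
  obtain ⟨C, hC0, hC⟩ := oscPoly_bounded p
  obtain ⟨D, hD0, hD⟩ := oscPoly_second_order p h1 h2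
  refine ⟨2 * C + 2 * D, by positivity, fun x _ ↦ ?_⟩
  have h := hC x
  have h' := hD x
  -- This is `(1 + x)² ≤ 2 + 2x²`, multiplied by the norm.
  nlinarith [mul_nonneg (sq_nonneg (1 - x)) (norm_nonneg (oscPoly p x))]

/-- The new density `iu p(u)` keeps the zeros of `p` at `±1`, so every derivative inherits the
quadratic decay. -/
theorem hasDerivAt_oscPoly (p : Polynomial ℂ) (x : ℝ) :
    HasDerivAt (oscPoly p) (oscPoly (Polynomial.C Complex.I * Polynomial.X * p) x) x := by
  have hc : Continuous fun u : ℝ ↦ (Polynomial.C Complex.I * Polynomial.X * p).eval (u : ℂ) := by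
    fun_prop
  obtain ⟨C, hC⟩ := isCompact_Icc.exists_bound_of_continuousOn (s := Set.Icc (-1 : ℝ) 1)
    hc.continuousOn
  refine (intervalIntegral.hasDerivAt_integral_of_dominated_loc_of_deriv_le
    (F := fun x u ↦ p.eval (u : ℂ) * Complex.exp (Complex.I * ((x * u : ℝ) : ℂ)))
    (F' := fun x u ↦ (Polynomial.C Complex.I * Polynomial.X * p).eval (u : ℂ) *
      Complex.exp (Complex.I * ((x * u : ℝ) : ℂ))) (bound := fun _ ↦ C)
    (s := Set.univ) Filter.univ_mem ?_ ?_ ?_ ?_ ?_ ?_).2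
  · refine Filter.Eventually.of_forall fun y ↦ Continuous.aestronglyMeasurable (by fun_prop)
  · exact Continuous.intervalIntegrable (by fun_prop) _ _
  · exact Continuous.aestronglyMeasurable (by fun_prop)
  · refine Filter.Eventually.of_forall fun u hu y _ ↦ ?_
    rw [norm_mul, norm_exp_I_mul_ofReal, mul_one]
    rw [Set.uIoc_of_le (by norm_num)] at hu
    exact hC u ⟨hu.1.le, hu.2⟩
  · exact intervalIntegrable_const
  · refine Filter.Eventually.of_forall fun u hu y _ ↦ ?_
    have := ((((hasDerivAt_id y).mul_const u).ofReal_comp.const_mul Complex.I).cexp).const_mul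
      (p.eval (u : ℂ))
    refine this.congr_deriv ?_
    simp only [Polynomial.eval_mul, Polynomial.eval_C, Polynomial.eval_X, id, one_mul]
    ring

/-! ### The quartic exponential and integration by parts on a half-line. -/

/-- The quartic exponential `e^{-a s⁴}`. -/
noncomputable def quarticExp (a : ℂ) (s : ℝ) : ℂ := Complex.exp (-a * ((s ^ 4 : ℝ) : ℂ))

theorem continuous_quarticExp (a : ℂ) : Continuous (quarticExp a) := by
  unfold quarticExp
  fun_prop

theorem norm_quarticExp (a : ℂ) (s : ℝ) : ‖quarticExp a s‖ = Real.exp (-a.re * s ^ 4) := by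
  rw [quarticExp, Complex.norm_exp, Complex.re_mul_ofReal, Complex.neg_re]

theorem norm_quarticExp_le_one {a : ℂ} (ha : 0 ≤ a.re) (s : ℝ) : ‖quarticExp a s‖ ≤ 1 := by
  rw [norm_quarticExp, Real.exp_le_one_iff]
  have : 0 ≤ s ^ 4 := by positivity
  nlinarith

theorem hasDerivAt_quarticExp (a : ℂ) (s : ℝ) :
    HasDerivAt (quarticExp a) (-4 * a * (s : ℂ) ^ 3 * quarticExp a s) s := by
  have := ((((hasDerivAt_id s).pow 4).ofReal_comp).const_mul (-a)).cexp
  refine this.congr_deriv ?_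
  simp only [quarticExp, id, Pi.pow_apply]
  push_cast
  ring

theorem integrableOn_pow_mul_exp_neg_quartic (n : ℕ) {δ : ℝ} (hδ : 0 < δ) :
    IntegrableOn (fun s : ℝ ↦ s ^ n * Real.exp (-δ * s ^ 4)) (Set.Ioi 0) := by
  have := integrableOn_rpow_mul_exp_neg_mul_rpow (s := n) (p := 4) (b := δ)
    (lt_of_lt_of_le (by norm_num) (Nat.cast_nonneg n)) (by norm_num) hδ
  refine this.congr_fun (fun s _ ↦ ?_) measurableSet_Ioi
  norm_cast

theorem integrableOn_mul_quarticExp {a : ℂ} (ha : 0 < a.re) {A D : ℝ} (hA : 0 ≤ A) (n : ℕ)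
    {F : ℝ → ℂ} (hF : ContinuousOn F (Set.Ioi A)) (hD : ∀ s, A < s → ‖F s‖ ≤ D * s ^ n) :
    IntegrableOn (fun s ↦ F s * quarticExp a s) (Set.Ioi A) := by
  have h1 := ((integrableOn_pow_mul_exp_neg_quartic n ha).mono_set
    (Set.Ioi_subset_Ioi hA)).const_mul D
  refine Integrable.mono' h1 ((hF.mul (continuous_quarticExp a).continuousOn).aestronglyMeasurable
    measurableSet_Ioi) ?_
  refine ae_restrict_of_forall_mem measurableSet_Ioi fun s hs ↦ ?_
  rw [norm_mul, norm_quarticExp, ← mul_assoc]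
  exact mul_le_mul_of_nonneg_right (hD s hs) (Real.exp_nonneg _)

theorem integral_Ioi_inv_cube {A : ℝ} (hA : 0 < A) :
    IntegrableOn (fun s : ℝ ↦ (s ^ 3)⁻¹) (Set.Ioi A) ∧
      ∫ s in Set.Ioi A, (s ^ 3)⁻¹ = (A ^ 2)⁻¹ / 2 := by
  have h : ∀ s ∈ Set.Ioi A, s ^ (-3 : ℝ) = (s ^ 3)⁻¹ := fun s hs ↦ by
    rw [Real.rpow_neg (hA.trans hs).le]; norm_cast
  refine ⟨(integrableOn_Ioi_rpow_of_lt (by norm_num) hA).congr_fun h measurableSet_Ioi, ?_⟩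
  rw [← setIntegral_congr_fun measurableSet_Ioi h, integral_Ioi_rpow_of_lt (by norm_num) hA]
  have : (-3 + 1 : ℝ) = -2 := by norm_num
  rw [this, Real.rpow_neg hA.le]
  norm_cast
  push_cast
  ring

/-- Two integrations by parts against `e^{-a s⁴}` on `(A, ∞)`. -/
theorem norm_integral_quartic_tail_le {a : ℂ} (ha : 0 < a.re) (ha1 : 1 ≤ ‖a‖) {A D : ℝ}
    (hA : 1 ≤ A) {F₀ F₁ F₂ : ℝ → ℂ}
    (h0 : ∀ s, A ≤ s → HasDerivAt F₀ ((s : ℂ) ^ 3 * F₁ s) s)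
    (h1 : ∀ s, A ≤ s → HasDerivAt F₁ (F₂ s) s)
    (hc : ContinuousOn F₂ (Set.Ioi A))
    (b0 : ∀ s, A ≤ s → ‖F₀ s‖ ≤ D * s ^ 2) (b1 : ∀ s, A ≤ s → ‖F₁ s‖ ≤ D * s ^ 2)
    (b2 : ∀ s, A ≤ s → ‖F₂ s‖ ≤ D * (s ^ 3)⁻¹) :
    ‖∫ s in Set.Ioi A, (s : ℂ) ^ 3 * F₀ s * quarticExp a s‖ ≤
      ‖F₀ A‖ + ‖F₁ A‖ + D * (A ^ 2)⁻¹ := by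
  have hA0 : 0 < A := by linarith
  have hD : 0 ≤ D := by
    have := (norm_nonneg _).trans (b0 A le_rfl)
    exact nonneg_of_mul_nonneg_left this (by positivity)
  have ha0 : a ≠ 0 := by
    rintro rfl; simp at ha
  -- The derivative of `e^{-as⁴}` is `-4a s³ e^{-as⁴}`. The estimate uses only `|q| ≤ 1` and
  -- `|e^{-as⁴}| ≤ 1`; `Re a > 0` serves for convergence alone, so the bound survives `Re a → 0`.
  set q : ℂ := (4 * a)⁻¹ with hq
  have hqa : 4 * a * q = 1 := by rw [hq]; field_simp
  have hqn : ‖q‖ ≤ 1 := by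
    rw [hq, norm_inv, norm_mul]
    have : ‖(4 : ℂ)‖ = 4 := by simp
    rw [this]
    exact inv_le_one_of_one_le₀ (by linarith)
  have hm : ∀ s, ‖quarticExp a s‖ ≤ 1 := norm_quarticExp_le_one ha.le
  have c0 : ContinuousOn F₀ (Set.Ioi A) := fun s hs ↦
    (h0 s (le_of_lt hs)).continuousAt.continuousWithinAt
  have c1 : ContinuousOn F₁ (Set.Ioi A) := fun s hs ↦
    (h1 s (le_of_lt hs)).continuousAt.continuousWithinAt
  have i0 : IntegrableOn (fun s : ℝ ↦ (s : ℂ) ^ 3 * F₀ s * quarticExp a s) (Set.Ioi A) := by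
    refine integrableOn_mul_quarticExp ha hA0.le 5 (D := D)
      (((Complex.continuous_ofReal.pow 3).continuousOn).mul c0) fun s hs ↦ ?_
    have hs0 : 0 < s := hA0.trans hs
    rw [norm_mul, norm_pow, Complex.norm_real, Real.norm_of_nonneg hs0.le]
    calc s ^ 3 * ‖F₀ s‖ ≤ s ^ 3 * (D * s ^ 2) := by gcongr; exact b0 s hs.le
      _ = D * s ^ 5 := by ring
  have i2 : IntegrableOn (fun s : ℝ ↦ F₂ s * quarticExp a s) (Set.Ioi A) := by
    refine integrableOn_mul_quarticExp ha hA0.le 0 (D := D) hc fun s hs ↦ ?_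
    refine (b2 s hs.le).trans (mul_le_mul_of_nonneg_left ?_ hD)
    exact inv_le_one_of_one_le₀ (one_le_pow₀ (hA.trans hs.le))
  have iH : IntegrableOn (fun s : ℝ ↦ (-q * F₀ s - q ^ 2 * F₁ s) * quarticExp a s)
      (Set.Ioi A) := by
    refine integrableOn_mul_quarticExp ha hA0.le 2 (D := D + D)
      ((c0.const_smul (-q)).sub (c1.const_smul (q ^ 2))) fun s hs ↦ ?_
    refine (norm_sub_le _ _).trans ?_
    rw [norm_mul, norm_mul, norm_neg, norm_pow, add_mul]
    refine add_le_add ?_ ?_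
    · exact (mul_le_of_le_one_left (norm_nonneg _) hqn).trans (b0 s hs.le)
    · exact (mul_le_of_le_one_left (norm_nonneg _) (pow_le_one₀ (norm_nonneg _) hqn)).trans
        (b1 s hs.le)
  -- The primitive collects the boundary terms of both integrations by parts; the `F₁` contributions
  -- cancel and only the remainder `q² F₂` is left.
  have hd : ∀ s ∈ Set.Ici A, HasDerivAt
      (fun s : ℝ ↦ (-q * F₀ s - q ^ 2 * F₁ s) * quarticExp a s)
      ((s : ℂ) ^ 3 * F₀ s * quarticExp a s - q ^ 2 * (F₂ s * quarticExp a s)) s := by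
    intro s hs
    refine ((((h0 s hs).const_mul (-q)).sub ((h1 s hs).const_mul (q ^ 2))).mul
      (hasDerivAt_quarticExp a s)).congr_deriv ?_
    simp only [Pi.sub_apply]
    linear_combination (quarticExp a s * s ^ 3 * F₀ s + quarticExp a s * s ^ 3 * F₁ s * q) * hqa
  have id : IntegrableOn (fun s : ℝ ↦ (s : ℂ) ^ 3 * F₀ s * quarticExp a s -
      q ^ 2 * (F₂ s * quarticExp a s)) (Set.Ioi A) := i0.sub (i2.const_mul _)
  have hlim := tendsto_zero_of_hasDerivAt_of_integrableOn_Ioi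
    (fun s hs ↦ hd s (Set.Ioi_subset_Ici_self hs)) id iH
  have key := integral_Ioi_of_hasDerivAt_of_tendsto' hd id hlim
  rw [integral_sub i0 (i2.const_mul _), integral_const_mul, sub_eq_iff_eq_add] at key
  rw [key, zero_sub]
  refine (norm_add_le _ _).trans (add_le_add ?_ ?_)
  · rw [norm_neg, norm_mul]
    refine (mul_le_of_le_one_right (norm_nonneg _) (hm A)).trans ((norm_sub_le _ _).trans ?_)
    rw [norm_mul, norm_mul, norm_neg, norm_pow]
    exact add_le_add (mul_le_of_le_one_left (norm_nonneg _) hqn)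
      (mul_le_of_le_one_left (norm_nonneg _) (pow_le_one₀ (norm_nonneg _) hqn))
  · rw [norm_mul, norm_pow]
    refine (mul_le_of_le_one_left (norm_nonneg _) (pow_le_one₀ (norm_nonneg _) hqn)).trans ?_
    have hi := integral_Ioi_inv_cube hA0
    refine (norm_integral_le_of_norm_le (hi.1.const_mul D)
      (ae_restrict_of_forall_mem measurableSet_Ioi fun s hs ↦ ?_)).trans ?_
    · rw [norm_mul]
      exact (mul_le_of_le_one_right (norm_nonneg _) (hm s)).trans (b2 s (le_of_lt hs))
    · rw [integral_const_mul, hi.2]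
      have : 0 ≤ (A ^ 2)⁻¹ := by positivity
      nlinarith [mul_nonneg hD this]

theorem hasDerivAt_comp_const_mul {f : ℝ → ℂ} {f' : ℂ} {r s : ℝ} (h : HasDerivAt f f' (r * s)) :
    HasDerivAt (fun s ↦ f (r * s)) (r * f') s := by
  refine (h.scomp s ((hasDerivAt_id s).const_mul r)).congr_deriv ?_
  simp

/-! ### Radial integrals, bounded uniformly in `r` and in `Re a`. -/

/-- A function on `ℝ` that, together with its first two derivatives, is bounded by
`D (1 + x)⁻²` for `x ≥ 0`. -/
structure QuadDecay (D : ℝ) (Ψ Ψ₁ Ψ₂ : ℝ → ℂ) : Prop where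
  deriv₀ : ∀ x, HasDerivAt Ψ (Ψ₁ x) x
  deriv₁ : ∀ x, HasDerivAt Ψ₁ (Ψ₂ x) x
  cont₂ : Continuous Ψ₂
  bound₀ : ∀ x, 0 ≤ x → (1 + x) ^ 2 * ‖Ψ x‖ ≤ D
  bound₁ : ∀ x, 0 ≤ x → (1 + x) ^ 2 * ‖Ψ₁ x‖ ≤ D
  bound₂ : ∀ x, 0 ≤ x → (1 + x) ^ 2 * ‖Ψ₂ x‖ ≤ D

namespace QuadDecay

variable {D : ℝ} {Ψ Ψ₁ Ψ₂ : ℝ → ℂ}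

theorem cont₀ (h : QuadDecay D Ψ Ψ₁ Ψ₂) : Continuous Ψ :=
  continuous_iff_continuousAt.2 fun x ↦ (h.deriv₀ x).continuousAt

theorem cont₁ (h : QuadDecay D Ψ Ψ₁ Ψ₂) : Continuous Ψ₁ :=
  continuous_iff_continuousAt.2 fun x ↦ (h.deriv₁ x).continuousAt

theorem le₀ (h : QuadDecay D Ψ Ψ₁ Ψ₂) {x : ℝ} (hx : 0 ≤ x) : ‖Ψ x‖ ≤ D := by
  nlinarith [h.bound₀ x hx, norm_nonneg (Ψ x), mul_nonneg hx (norm_nonneg (Ψ x)),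
    mul_nonneg (sq_nonneg x) (norm_nonneg (Ψ x))]

theorem sq_le₀ (h : QuadDecay D Ψ Ψ₁ Ψ₂) {x : ℝ} (hx : 0 ≤ x) : x ^ 2 * ‖Ψ x‖ ≤ D := by
  nlinarith [h.bound₀ x hx, norm_nonneg (Ψ x), mul_nonneg hx (norm_nonneg (Ψ x)),
    mul_nonneg (sq_nonneg x) (norm_nonneg (Ψ x))]

theorem le₁ (h : QuadDecay D Ψ Ψ₁ Ψ₂) {x : ℝ} (hx : 0 ≤ x) : x * ‖Ψ₁ x‖ ≤ D := by
  nlinarith [h.bound₁ x hx, norm_nonneg (Ψ₁ x), mul_nonneg hx (norm_nonneg (Ψ₁ x)),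
    mul_nonneg (sq_nonneg x) (norm_nonneg (Ψ₁ x))]

theorem le₂ (h : QuadDecay D Ψ Ψ₁ Ψ₂) {x : ℝ} (hx : 0 ≤ x) : x ^ 2 * ‖Ψ₂ x‖ ≤ D := by
  nlinarith [h.bound₂ x hx, norm_nonneg (Ψ₂ x), mul_nonneg hx (norm_nonneg (Ψ₂ x)),
    mul_nonneg (sq_nonneg x) (norm_nonneg (Ψ₂ x))]

theorem nonneg (h : QuadDecay D Ψ Ψ₁ Ψ₂) : 0 ≤ D := (norm_nonneg _).trans (h.le₀ le_rfl)

/-- Each `s`-derivative of `Ψ(rs)` produces a factor `r`, which is paired with a factor `s`. The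
terms `(rs)^k Ψ^{(k)}(rs)`, `k ≤ 2`, are bounded independently of `r`, which makes the tail
estimates uniform. -/
theorem norm_comb_le (h : QuadDecay D Ψ Ψ₁ Ψ₂) {x : ℝ} (hx : 0 ≤ x) (α β γ : ℝ) :
    ‖(α : ℂ) * Ψ x + (β : ℂ) * (x * Ψ₁ x) + (γ : ℂ) * ((x : ℂ) ^ 2 * Ψ₂ x)‖ ≤
      (|α| + |β| + |γ|) * D := by
  refine (norm_add₃_le).trans ?_
  simp only [norm_mul, norm_pow, Complex.norm_real, Real.norm_eq_abs, abs_of_nonneg hx, add_mul]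
  gcongr
  · exact h.le₀ hx
  · exact h.le₁ hx
  · exact h.le₂ hx

theorem integrableOn (h : QuadDecay D Ψ Ψ₁ Ψ₂) {a : ℂ} (ha : 0 < a.re) (n : ℕ) {r A : ℝ}
    (hr : 0 ≤ r) (hA : 0 ≤ A) :
    IntegrableOn (fun s : ℝ ↦ (s : ℂ) ^ n * Ψ (r * s) * quarticExp a s) (Set.Ioi A) := by
  have := h.cont₀
  refine integrableOn_mul_quarticExp ha hA n (D := D)
    (Continuous.continuousOn (by fun_prop)) fun s hs ↦ ?_
  have hs0 : 0 ≤ s := hA.trans hs.le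
  rw [norm_mul, norm_pow, Complex.norm_real, Real.norm_of_nonneg hs0, mul_comm D]
  gcongr
  exact h.le₀ (by positivity)

/-- Apply `norm_integral_quartic_tail_le` to `F₀ = sΨ(rs)`. The boundary term `A‖Ψ(rA)‖` is kept as
it stands because it becomes small when `r` is large. -/
theorem tail_four (h : QuadDecay D Ψ Ψ₁ Ψ₂) {a : ℂ} (ha : 0 < a.re) (ha1 : 1 ≤ ‖a‖) {r A : ℝ}
    (hr : 0 ≤ r) (hA : 1 ≤ A) :
    ‖∫ s in Set.Ioi A, (s : ℂ) ^ 4 * Ψ (r * s) * quarticExp a s‖ ≤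
      A * ‖Ψ (r * A)‖ + 7 * D * (A ^ 2)⁻¹ := by
  have hD := h.nonneg
  have e1 : ∀ s, A ≤ s → ((s : ℂ)) ≠ 0 := fun s hs ↦ by
    have : s ≠ 0 := by linarith
    exact_mod_cast this
  have d0 : ∀ s, HasDerivAt (fun s ↦ Ψ (r * s)) (r * Ψ₁ (r * s)) s := fun s ↦
    hasDerivAt_comp_const_mul (h.deriv₀ (r * s))
  have d1 : ∀ s, HasDerivAt (fun s ↦ Ψ₁ (r * s)) (r * Ψ₂ (r * s)) s := fun s ↦
    hasDerivAt_comp_const_mul (h.deriv₁ (r * s))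
  have dp : ∀ s : ℝ, A ≤ s → HasDerivAt (fun s : ℝ ↦ (s : ℂ)⁻¹) (-((s : ℂ)⁻¹) ^ 2) s :=
    fun s hs ↦ by
      simpa using (hasDerivAt_inv (e1 s hs)).comp_ofReal
  have bF1 : ∀ s : ℝ, A ≤ s → ‖((s : ℂ)⁻¹) ^ 3 * Ψ (r * s) +
      (r : ℂ) * ((s : ℂ)⁻¹) ^ 2 * Ψ₁ (r * s)‖ ≤ 2 * D * (s ^ 3)⁻¹ := by
    intro s hs
    have hs0 : 0 < s := by linarith
    have h3 := h.norm_comb_le (x := r * s) (by positivity) 1 1 0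
    have : ((s : ℂ)⁻¹) ^ 3 * Ψ (r * s) + (r : ℂ) * ((s : ℂ)⁻¹) ^ 2 * Ψ₁ (r * s) =
      ((s : ℂ)⁻¹) ^ 3 * (((1 : ℝ) : ℂ) * Ψ (r * s) + ((1 : ℝ) : ℂ) * (((r * s : ℝ) : ℂ) *
        Ψ₁ (r * s)) + ((0 : ℝ) : ℂ) * ((((r * s : ℝ) : ℂ)) ^ 2 * Ψ₂ (r * s))) := by
      have := e1 s hs
      push_cast
      field_simp
      ring
    rw [this, norm_mul, norm_pow, norm_inv, Complex.norm_real, Real.norm_of_nonneg hs0.le,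
      inv_pow, mul_comm]
    refine mul_le_mul_of_nonneg_right (h3.trans (le_of_eq ?_)) (by positivity)
    norm_num
  have key := norm_integral_quartic_tail_le (a := a) ha ha1 (A := A) (D := 5 * D) hA
    (F₀ := fun s ↦ (s : ℂ) * Ψ (r * s))
    (F₁ := fun s ↦ ((s : ℂ)⁻¹) ^ 3 * Ψ (r * s) + (r : ℂ) * ((s : ℂ)⁻¹) ^ 2 * Ψ₁ (r * s))
    (F₂ := fun s ↦ -3 * ((s : ℂ)⁻¹) ^ 4 * Ψ (r * s) - r * ((s : ℂ)⁻¹) ^ 3 * Ψ₁ (r * s) +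
      (r : ℂ) ^ 2 * ((s : ℂ)⁻¹) ^ 2 * Ψ₂ (r * s)) ?_ ?_ ?_ ?_ ?_ ?_
  · have e2 : ∀ s : ℝ, (s : ℂ) ^ 3 * ((s : ℂ) * Ψ (r * s)) = (s : ℂ) ^ 4 * Ψ (r * s) :=
      fun s ↦ by ring
    simp only [e2] at key
    refine key.trans ?_
    have h4 := bF1 A le_rfl
    rw [norm_mul, Complex.norm_real, Real.norm_of_nonneg (by linarith : 0 ≤ A)]
    have h5 : (A ^ 3)⁻¹ ≤ (A ^ 2)⁻¹ :=
      inv_anti₀ (by positivity) (pow_le_pow_right₀ hA (by norm_num))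
    nlinarith
  · intro s hs
    refine (((hasDerivAt_id s).ofReal_comp).mul (d0 s)).congr_deriv ?_
    have := e1 s hs
    simp only [id]
    push_cast
    field_simp
  · intro s hs
    refine ((((dp s hs).pow 3).mul (d0 s)).add
      ((((dp s hs).pow 2).const_mul (r : ℂ)).mul (d1 s))).congr_deriv ?_
    simp only [Pi.pow_apply]
    push_cast
    ring
  · have hi : ContinuousOn (fun s : ℝ ↦ (s : ℂ)⁻¹) (Set.Ioi A) := fun s hs ↦
      (dp s hs.le).continuousAt.continuousWithinAt
    have := h.cont₀
    have := h.cont₁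
    have := h.cont₂
    fun_prop
  · intro s hs
    have hs0 : 0 < s := by linarith
    rw [norm_mul, Complex.norm_real, Real.norm_of_nonneg hs0.le]
    have := h.le₀ (x := r * s) (by positivity)
    have h6 : s ≤ s ^ 2 := by nlinarith
    calc s * ‖Ψ (r * s)‖ ≤ s ^ 2 * (5 * D) := by gcongr; linarith
      _ = _ := by ring
  · intro s hs
    refine (bF1 s hs).trans ?_
    have h6 : (s ^ 3)⁻¹ ≤ 1 := inv_le_one_of_one_le₀ (one_le_pow₀ (hA.trans hs))
    have h7 : 1 ≤ s ^ 2 := one_le_pow₀ (hA.trans hs)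
    have h8 : 0 ≤ (s ^ 3)⁻¹ := inv_nonneg.2 (pow_nonneg (by linarith) _)
    nlinarith
  · intro s hs
    have hs0 : 0 < s := by linarith
    have h3 := h.norm_comb_le (x := r * s) (by positivity) (-3) (-1) 1
    have : -3 * ((s : ℂ)⁻¹) ^ 4 * Ψ (r * s) - r * ((s : ℂ)⁻¹) ^ 3 * Ψ₁ (r * s) +
      (r : ℂ) ^ 2 * ((s : ℂ)⁻¹) ^ 2 * Ψ₂ (r * s) =
      ((s : ℂ)⁻¹) ^ 4 * (((-3 : ℝ) : ℂ) * Ψ (r * s) + ((-1 : ℝ) : ℂ) * (((r * s : ℝ) : ℂ) *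
        Ψ₁ (r * s)) + ((1 : ℝ) : ℂ) * ((((r * s : ℝ) : ℂ)) ^ 2 * Ψ₂ (r * s))) := by
      have := e1 s hs
      push_cast
      field_simp
      ring
    rw [this, norm_mul, norm_pow, norm_inv, Complex.norm_real, Real.norm_of_nonneg hs0.le,
      inv_pow, mul_comm]
    refine mul_le_mul (h3.trans (le_of_eq ?_)) ?_ (by positivity) (by positivity)
    · norm_num [abs_of_nonneg]
    · exact inv_anti₀ (by positivity) (pow_le_pow_right₀ (hA.trans hs) (by norm_num))

/-- The fifth power arises from differentiating `∫ s⁴ Ψ(rs) e^{-as⁴} ds` in `r`. The constant is `1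
+ 3 + 6`, from `F₀(1)`, `F₁(1)` and the integral of `F₂`. -/
theorem tail_five (h : QuadDecay D Ψ Ψ₁ Ψ₂) {a : ℂ} (ha : 0 < a.re) (ha1 : 1 ≤ ‖a‖) {r : ℝ}
    (hr : 0 ≤ r) :
    ‖∫ s in Set.Ioi (1 : ℝ), (s : ℂ) ^ 5 * Ψ (r * s) * quarticExp a s‖ ≤ 10 * D := by
  have hD := h.nonneg
  have e1 : ∀ s : ℝ, 1 ≤ s → ((s : ℂ)) ≠ 0 := fun s hs ↦ by
    have : s ≠ 0 := by linarith
    exact_mod_cast this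
  have d0 : ∀ s, HasDerivAt (fun s ↦ Ψ (r * s)) (r * Ψ₁ (r * s)) s := fun s ↦
    hasDerivAt_comp_const_mul (h.deriv₀ (r * s))
  have d1 : ∀ s, HasDerivAt (fun s ↦ Ψ₁ (r * s)) (r * Ψ₂ (r * s)) s := fun s ↦
    hasDerivAt_comp_const_mul (h.deriv₁ (r * s))
  have dp : ∀ s : ℝ, 1 ≤ s → HasDerivAt (fun s : ℝ ↦ (s : ℂ)⁻¹) (-((s : ℂ)⁻¹) ^ 2) s :=
    fun s hs ↦ by
      simpa using (hasDerivAt_inv (e1 s hs)).comp_ofReal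
  have bF1 : ∀ s : ℝ, 1 ≤ s → ‖2 * ((s : ℂ)⁻¹) ^ 2 * Ψ (r * s) +
      (r : ℂ) * (s : ℂ)⁻¹ * Ψ₁ (r * s)‖ ≤ 3 * D * (s ^ 2)⁻¹ := by
    intro s hs
    have hs0 : 0 < s := by linarith
    have h3 := h.norm_comb_le (x := r * s) (by positivity) 2 1 0
    have : 2 * ((s : ℂ)⁻¹) ^ 2 * Ψ (r * s) + (r : ℂ) * (s : ℂ)⁻¹ * Ψ₁ (r * s) =
      ((s : ℂ)⁻¹) ^ 2 * (((2 : ℝ) : ℂ) * Ψ (r * s) + ((1 : ℝ) : ℂ) * (((r * s : ℝ) : ℂ) *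
        Ψ₁ (r * s)) + ((0 : ℝ) : ℂ) * ((((r * s : ℝ) : ℂ)) ^ 2 * Ψ₂ (r * s))) := by
      have := e1 s hs
      push_cast
      field_simp
      ring
    rw [this, norm_mul, norm_pow, norm_inv, Complex.norm_real, Real.norm_of_nonneg hs0.le,
      inv_pow, mul_comm]
    refine mul_le_mul_of_nonneg_right (h3.trans (le_of_eq ?_)) (by positivity)
    norm_num
  have key := norm_integral_quartic_tail_le (a := a) ha ha1 (A := 1) (D := 6 * D) le_rfl
    (F₀ := fun s ↦ (s : ℂ) ^ 2 * Ψ (r * s))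
    (F₁ := fun s ↦ 2 * ((s : ℂ)⁻¹) ^ 2 * Ψ (r * s) + (r : ℂ) * (s : ℂ)⁻¹ * Ψ₁ (r * s))
    (F₂ := fun s ↦ -4 * ((s : ℂ)⁻¹) ^ 3 * Ψ (r * s) + r * ((s : ℂ)⁻¹) ^ 2 * Ψ₁ (r * s) +
      (r : ℂ) ^ 2 * (s : ℂ)⁻¹ * Ψ₂ (r * s)) ?_ ?_ ?_ ?_ ?_ ?_
  · have e2 : ∀ s : ℝ, (s : ℂ) ^ 3 * ((s : ℂ) ^ 2 * Ψ (r * s)) = (s : ℂ) ^ 5 * Ψ (r * s) :=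
      fun s ↦ by ring
    simp only [e2] at key
    refine key.trans ?_
    have h4 := bF1 1 le_rfl
    have h5 := h.le₀ (x := r * 1) (by positivity)
    have h6 : ‖((1 : ℝ) : ℂ) ^ 2 * Ψ (r * 1)‖ = ‖Ψ (r * 1)‖ := by simp
    rw [h6]
    norm_num at h4 h5 ⊢
    linarith
  · intro s hs
    refine (((hasDerivAt_id s).ofReal_comp.pow 2).mul (d0 s)).congr_deriv ?_
    have := e1 s hs
    simp only [id, Pi.pow_apply]
    push_cast
    field_simp
  · intro s hs
    refine (((((dp s hs).pow 2).const_mul 2).mul (d0 s)).add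
      (((dp s hs).const_mul (r : ℂ)).mul (d1 s))).congr_deriv ?_
    simp only [Pi.pow_apply]
    push_cast
    ring
  · have hi : ContinuousOn (fun s : ℝ ↦ (s : ℂ)⁻¹) (Set.Ioi 1) := fun s hs ↦
      (dp s (le_of_lt hs)).continuousAt.continuousWithinAt
    have := h.cont₀
    have := h.cont₁
    have := h.cont₂
    fun_prop
  · intro s hs
    have hs0 : 0 < s := by linarith
    rw [norm_mul, norm_pow, Complex.norm_real, Real.norm_of_nonneg hs0.le]
    have := h.le₀ (x := r * s) (by positivity)
    calc s ^ 2 * ‖Ψ (r * s)‖ ≤ s ^ 2 * (6 * D) := by gcongr; linarith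
      _ = _ := by ring
  · intro s hs
    refine (bF1 s hs).trans ?_
    have h6 : (s ^ 2)⁻¹ ≤ 1 := inv_le_one_of_one_le₀ (one_le_pow₀ hs)
    have h7 : 1 ≤ s ^ 2 := one_le_pow₀ hs
    have h8 : 0 ≤ (s ^ 2)⁻¹ := inv_nonneg.2 (pow_nonneg (by linarith) _)
    nlinarith
  · intro s hs
    have hs0 : 0 < s := by linarith
    have h3 := h.norm_comb_le (x := r * s) (by positivity) (-4) 1 1
    have : -4 * ((s : ℂ)⁻¹) ^ 3 * Ψ (r * s) + r * ((s : ℂ)⁻¹) ^ 2 * Ψ₁ (r * s) +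
      (r : ℂ) ^ 2 * (s : ℂ)⁻¹ * Ψ₂ (r * s) =
      ((s : ℂ)⁻¹) ^ 3 * (((-4 : ℝ) : ℂ) * Ψ (r * s) + ((1 : ℝ) : ℂ) * (((r * s : ℝ) : ℂ) *
        Ψ₁ (r * s)) + ((1 : ℝ) : ℂ) * ((((r * s : ℝ) : ℂ)) ^ 2 * Ψ₂ (r * s))) := by
      have := e1 s hs
      push_cast
      field_simp
    rw [this, norm_mul, norm_pow, norm_inv, Complex.norm_real, Real.norm_of_nonneg hs0.le,
      inv_pow, mul_comm]
    refine mul_le_mul_of_nonneg_right (h3.trans (le_of_eq ?_)) (by positivity)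
    norm_num [abs_of_nonneg]

/-- The radial integral `∫_0^∞ s⁵ Ψ(rs) e^{-a s⁴} ds` is bounded uniformly in `r`. -/
theorem radial_five (h : QuadDecay D Ψ Ψ₁ Ψ₂) {a : ℂ} (ha : 0 < a.re) (ha1 : 1 ≤ ‖a‖) {r : ℝ}
    (hr : 0 ≤ r) :
    ‖∫ s in Set.Ioi (0 : ℝ), (s : ℂ) ^ 5 * Ψ (r * s) * quarticExp a s‖ ≤ 11 * D := by
  have hi := h.integrableOn ha 5 hr le_rfl
  have hu : Set.Ioi (0 : ℝ) = Set.Ioc 0 1 ∪ Set.Ioi 1 :=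
    (Set.Ioc_union_Ioi_eq_Ioi zero_le_one).symm
  rw [hu, setIntegral_union (Set.Ioc_disjoint_Ioi le_rfl) measurableSet_Ioi
    (hi.mono_set Set.Ioc_subset_Ioi_self) (hi.mono_set (Set.Ioi_subset_Ioi zero_le_one))]
  refine (norm_add_le _ _).trans ?_
  have h1 := h.tail_five ha ha1 hr
  have h2 : ‖∫ s in Set.Ioc (0 : ℝ) 1, (s : ℂ) ^ 5 * Ψ (r * s) * quarticExp a s‖ ≤ D := by
    refine (norm_setIntegral_le_of_norm_le_const (C := D) (by simp) fun s hs ↦ ?_).trans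
      (by simp)
    rw [norm_mul, norm_mul, norm_pow, Complex.norm_real, Real.norm_of_nonneg hs.1.le]
    refine (mul_le_of_le_one_right (mul_nonneg (pow_nonneg hs.1.le _) (norm_nonneg _))
      (norm_quarticExp_le_one ha.le s)).trans ?_
    exact (mul_le_of_le_one_left (norm_nonneg _) (pow_le_one₀ hs.1.le hs.2)).trans
      (h.le₀ (mul_nonneg hr hs.1.le))
  linarith

/-- The radial integral `∫_0^∞ s⁴ Ψ(rs) e^{-a s⁴} ds` is bounded uniformly in `r`. -/
theorem radial_four (h : QuadDecay D Ψ Ψ₁ Ψ₂) {a : ℂ} (ha : 0 < a.re) (ha1 : 1 ≤ ‖a‖) {r : ℝ}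
    (hr : 0 ≤ r) :
    ‖∫ s in Set.Ioi (0 : ℝ), (s : ℂ) ^ 4 * Ψ (r * s) * quarticExp a s‖ ≤ 9 * D := by
  have hi := h.integrableOn ha 4 hr le_rfl
  have hu : Set.Ioi (0 : ℝ) = Set.Ioc 0 1 ∪ Set.Ioi 1 :=
    (Set.Ioc_union_Ioi_eq_Ioi zero_le_one).symm
  rw [hu, setIntegral_union (Set.Ioc_disjoint_Ioi le_rfl) measurableSet_Ioi
    (hi.mono_set Set.Ioc_subset_Ioi_self) (hi.mono_set (Set.Ioi_subset_Ioi zero_le_one))]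
  refine (norm_add_le _ _).trans ?_
  have h1 := h.tail_four ha ha1 hr le_rfl
  have h3 := h.le₀ (x := r * 1) (by positivity)
  have h2 : ‖∫ s in Set.Ioc (0 : ℝ) 1, (s : ℂ) ^ 4 * Ψ (r * s) * quarticExp a s‖ ≤ D := by
    refine (norm_setIntegral_le_of_norm_le_const (C := D) (by simp) fun s hs ↦ ?_).trans
      (by simp)
    rw [norm_mul, norm_mul, norm_pow, Complex.norm_real, Real.norm_of_nonneg hs.1.le]
    refine (mul_le_of_le_one_right (mul_nonneg (pow_nonneg hs.1.le _) (norm_nonneg _))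
      (norm_quarticExp_le_one ha.le s)).trans ?_
    exact (mul_le_of_le_one_left (norm_nonneg _) (pow_le_one₀ hs.1.le hs.2)).trans
      (h.le₀ (mul_nonneg hr hs.1.le))
  norm_num at h1
  norm_num at h3
  linarith

/-- Decay of the radial integral `∫_0^∞ s⁴ Ψ(rs) e^{-a s⁴} ds` at `r = A³`. -/
theorem radial_four_decay (h : QuadDecay D Ψ Ψ₁ Ψ₂) {a : ℂ} (ha : 0 < a.re) (ha1 : 1 ≤ ‖a‖)
    {A : ℝ} (hA : 1 ≤ A) :
    A * ‖∫ s in Set.Ioi (0 : ℝ), (s : ℂ) ^ 4 * Ψ (A ^ 3 * s) * quarticExp a s‖ ≤ 9 * D := by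
  have hD := h.nonneg
  have hA0 : 0 < A := by linarith
  have hr : 0 ≤ A ^ 3 := by positivity
  have hi := h.integrableOn ha 4 hr le_rfl
  -- The cut `A = r^{1/3}` is the scale at which the phases `rs` and `s⁴` balance. Below it the
  -- decay `‖Ψ(x)‖ ≤ D x⁻²` suffices; above it the quartic phase is integrated by parts.
  have hu : Set.Ioi (0 : ℝ) = Set.Ioc 0 A ∪ Set.Ioi A :=
    (Set.Ioc_union_Ioi_eq_Ioi hA0.le).symm
  have h1 := h.tail_four ha ha1 hr hA
  have h3 : A * ‖Ψ (A ^ 3 * A)‖ ≤ D * (A ^ 2)⁻¹ := by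
    have h4 := h.sq_le₀ (x := A ^ 3 * A) (by positivity)
    rw [← div_eq_mul_inv, le_div_iff₀ (by positivity)]
    refine le_trans ?_ h4
    rw [mul_right_comm]
    refine mul_le_mul_of_nonneg_right ?_ (norm_nonneg _)
    calc A * A ^ 2 = A ^ 3 := by ring
      _ ≤ A ^ 8 := pow_le_pow_right₀ hA (by norm_num)
      _ = _ := by ring
  have h2 : ‖∫ s in Set.Ioc (0 : ℝ) A, (s : ℂ) ^ 4 * Ψ (A ^ 3 * s) * quarticExp a s‖ ≤
      D * (A ^ 3)⁻¹ := by
    refine (norm_setIntegral_le_of_norm_le_const (C := D * (A ^ 4)⁻¹) (by simp)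
      fun s hs ↦ ?_).trans (le_of_eq ?_)
    · rw [norm_mul, norm_mul, norm_pow, Complex.norm_real, Real.norm_of_nonneg hs.1.le]
      refine (mul_le_of_le_one_right (mul_nonneg (pow_nonneg hs.1.le _) (norm_nonneg _))
      (norm_quarticExp_le_one ha.le s)).trans ?_
      have h4 := h.sq_le₀ (x := A ^ 3 * s) (mul_nonneg hr hs.1.le)
      rw [← div_eq_mul_inv, le_div_iff₀ (by positivity)]
      calc s ^ 4 * ‖Ψ (A ^ 3 * s)‖ * A ^ 4 = s ^ 2 * (s ^ 2 * A ^ 4 * ‖Ψ (A ^ 3 * s)‖) := by ring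
        _ ≤ A ^ 2 * (s ^ 2 * A ^ 4 * ‖Ψ (A ^ 3 * s)‖) := by
          gcongr
          · exact hs.1.le
          · exact hs.2
        _ = (A ^ 3 * s) ^ 2 * ‖Ψ (A ^ 3 * s)‖ := by ring
        _ ≤ D := h4
    · simp [hA0.le]
      field_simp
  -- The decay obtained is `A⁻²`; the conclusion retains only one power of it.
  have h5 : ‖∫ s in Set.Ioi (0 : ℝ), (s : ℂ) ^ 4 * Ψ (A ^ 3 * s) * quarticExp a s‖ ≤
      9 * D * (A ^ 2)⁻¹ := by
    rw [hu, setIntegral_union (Set.Ioc_disjoint_Ioi le_rfl) measurableSet_Ioi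
      (hi.mono_set Set.Ioc_subset_Ioi_self) (hi.mono_set (Set.Ioi_subset_Ioi hA0.le))]
    refine (norm_add_le _ _).trans ?_
    have h5 : (A ^ 3)⁻¹ ≤ (A ^ 2)⁻¹ :=
      inv_anti₀ (by positivity) (pow_le_pow_right₀ hA (by norm_num))
    nlinarith
  calc A * _ ≤ A * (9 * D * (A ^ 2)⁻¹) := by gcongr
    _ = 9 * D * A⁻¹ := by field_simp
    _ ≤ 9 * D := mul_le_of_le_one_right (by positivity) (inv_le_one_of_one_le₀ hA)

end QuadDecay

/-! ### The regularized kernel on `ℝ⁵` and its reduction to a radial integral. -/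

/-- The Fourier integral `∫ e^{i y·ξ} e^{-a |ξ|⁴} dξ` over `ℝ⁵`. -/
noncomputable def quarticKernel (a : ℂ) (y : E5) : ℂ :=
  ∫ ξ : E5, Complex.exp (Complex.I * ((inner ℝ y ξ : ℝ) : ℂ)) * quarticExp a ‖ξ‖

theorem integrable_quarticExp_norm {a : ℂ} (ha : 0 < a.re) :
    Integrable fun ξ : E5 ↦ quarticExp a ‖ξ‖ := by
  rw [integrable_fun_norm_addHaar (E := E5) volume (f := quarticExp a)]
  have := integrableOn_mul_quarticExp ha (A := 0) (D := 1) le_rfl 4 (F := fun s ↦ (s : ℂ) ^ 4)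
    (Continuous.continuousOn (by fun_prop)) (fun s hs ↦ by
      rw [norm_pow, Complex.norm_real, Real.norm_of_nonneg hs.le, one_mul])
  refine this.congr_fun (fun s _ ↦ ?_) measurableSet_Ioi
  simp

/-- Follow an arbitrary isometry by the reflection that exchanges two vectors of equal norm. -/
theorem exists_linearIsometryEquiv_prod (y : E5) :
    ∃ L : E5 ≃ₗᵢ[ℝ] WithLp 2 (ℝ × EuclideanSpace ℝ (Fin 4)),
      L y = WithLp.toLp 2 (‖y‖, 0) := by
  have hfr : Module.finrank ℝ E5 = 5 := by simp [E5]
  have hfr' : Module.finrank ℝ (WithLp 2 (ℝ × EuclideanSpace ℝ (Fin 4))) = 5 := by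
    rw [(WithLp.linearEquiv 2 ℝ (ℝ × EuclideanSpace ℝ (Fin 4))).finrank_eq]
    simp
  let L₀ : E5 ≃ₗᵢ[ℝ] WithLp 2 (ℝ × EuclideanSpace ℝ (Fin 4)) :=
    (stdOrthonormalBasis ℝ E5).equiv
      (stdOrthonormalBasis ℝ (WithLp 2 (ℝ × EuclideanSpace ℝ (Fin 4)))) (finCongr (by rw [hfr, hfr']))
  have hn : ‖L₀ y‖ = ‖(WithLp.toLp 2 (‖y‖, 0) : WithLp 2 (ℝ × EuclideanSpace ℝ (Fin 4)))‖ := by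
    rw [L₀.norm_map, WithLp.prod_norm_eq_of_L2]
    simp
  exact ⟨L₀.trans (Submodule.reflection (Submodule.span ℝ {L₀ y - WithLp.toLp 2 (‖y‖, 0)})ᗮ),
    Submodule.reflection_sub hn⟩

theorem integral_E5_eq_integral_prod (y : E5) (g : ℝ → ℂ) :
    ∫ ξ : E5, Complex.exp (Complex.I * ((inner ℝ y ξ : ℝ) : ℂ)) * g ‖ξ‖ =
      ∫ p : ℝ × EuclideanSpace ℝ (Fin 4),
        Complex.exp (Complex.I * ((‖y‖ * p.1 : ℝ) : ℂ)) * g (√(p.1 ^ 2 + ‖p.2‖ ^ 2)) := by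
  obtain ⟨L, hL⟩ := exists_linearIsometryEquiv_prod y
  have h1 := (L.symm.measurePreserving).integral_comp
    L.symm.toHomeomorph.measurableEmbedding
    (fun ξ : E5 ↦ Complex.exp (Complex.I * ((inner ℝ y ξ : ℝ) : ℂ)) * g ‖ξ‖)
  have h2 := (WithLp.volume_preserving_toLp ℝ (EuclideanSpace ℝ (Fin 4))).integral_comp
    (MeasurableEquiv.toLp 2 (ℝ × EuclideanSpace ℝ (Fin 4))).measurableEmbedding
    (fun w ↦ Complex.exp (Complex.I * ((inner ℝ y (L.symm w) : ℝ) : ℂ)) * g ‖L.symm w‖)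
  rw [← h1, ← h2]
  congr 1
  ext p
  have h3 : inner ℝ y (L.symm (WithLp.toLp 2 p)) = ‖y‖ * p.1 := by
    rw [← L.inner_map_map, hL, L.apply_symm_apply, WithLp.prod_inner_apply]
    simp [mul_comm]
  rw [h3, L.symm.norm_map, WithLp.prod_norm_eq_of_L2]
  simp

theorem sqrt_pow_four {x : ℝ} (hx : 0 ≤ x) : √x ^ 4 = x ^ 2 := by
  rw [show √x ^ 4 = (√x ^ 2) ^ 2 by ring, Real.sq_sqrt hx]

theorem norm_quarticExp_sqrt_le {a : ℂ} (ha : 0 ≤ a.re) (v s : ℝ) :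
    ‖quarticExp a (√(v ^ 2 + s ^ 2))‖ ≤
      Real.exp (-a.re * v ^ 4) * Real.exp (-a.re * s ^ 4) := by
  rw [norm_quarticExp, sqrt_pow_four (by positivity), ← Real.exp_add, Real.exp_le_exp]
  nlinarith [mul_nonneg ha (mul_nonneg (sq_nonneg v) (sq_nonneg s))]

theorem integrable_exp_neg_quartic {δ : ℝ} (hδ : 0 < δ) :
    Integrable fun v : ℝ ↦ Real.exp (-δ * v ^ 4) := by
  have h := (integrable_exp_neg_mul_sq (mul_pos two_pos hδ)).const_mul (Real.exp δ)
  refine h.mono' (Continuous.aestronglyMeasurable (by fun_prop))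
    (Filter.Eventually.of_forall fun v ↦ ?_)
  rw [Real.norm_of_nonneg (Real.exp_nonneg _), ← Real.exp_add, Real.exp_le_exp]
  nlinarith [mul_nonneg hδ.le (sq_nonneg (v ^ 2 - 1))]

theorem oscPoly_eq_integral_sin (x : ℝ) :
    ∫ θ in (0 : ℝ)..Real.pi, ((Real.sin θ ^ 3 : ℝ) : ℂ) *
        Complex.exp (Complex.I * ((x * Real.cos θ : ℝ) : ℂ)) =
      oscPoly (1 - Polynomial.X ^ 2) x := by
  have h := intervalIntegral.integral_deriv_smul_comp (a := 0) (b := Real.pi) (f := Real.cos)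
    (f' := fun θ ↦ -Real.sin θ)
    (g := fun u : ℝ ↦ (1 - Polynomial.X ^ 2 : Polynomial ℂ).eval (u : ℂ) *
      Complex.exp (Complex.I * ((x * u : ℝ) : ℂ)))
    (fun θ _ ↦ Real.hasDerivAt_cos θ) (Real.continuous_sin.neg.continuousOn) (by fun_prop)
  rw [Real.cos_zero, Real.cos_pi, intervalIntegral.integral_symm (-1) 1] at h
  rw [oscPoly, ← neg_inj, ← h, ← intervalIntegral.integral_neg]
  refine intervalIntegral.integral_congr fun θ _ ↦ ?_
  have hs : (Real.sin θ : ℂ) ^ 2 = 1 - (Real.cos θ : ℂ) ^ 2 := by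
    have := Real.sin_sq θ
    exact_mod_cast congrArg (fun x : ℝ ↦ (x : ℂ)) this
  simp only [Function.comp, Polynomial.eval_sub, Polynomial.eval_one, Polynomial.eval_pow,
    Polynomial.eval_X, ← hs, Complex.real_smul]
  push_cast
  ring

/-- Polar coordinates turn `s³ dv ds` into `s⁴ sin³θ ds dθ`, and `u = cos θ` turns `sin³θ dθ` into
the density `1 - u²`. -/
theorem integral_half_plane_eq_radial {a : ℂ} (ha : 0 < a.re) (r : ℝ) :
    ∫ v : ℝ, ∫ s in Set.Ioi (0 : ℝ), Complex.exp (Complex.I * ((r * v : ℝ) : ℂ)) *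
        ((s : ℂ) ^ 3 * quarticExp a (√(v ^ 2 + s ^ 2))) =
      ∫ s in Set.Ioi (0 : ℝ),
        (s : ℂ) ^ 4 * oscPoly (1 - Polynomial.X ^ 2) (r * s) * quarticExp a s := by
  set G : ℝ × ℝ → ℂ := fun p ↦ Complex.exp (Complex.I * ((r * p.1 : ℝ) : ℂ)) *
    ((p.2 : ℂ) ^ 3 * quarticExp a (√(p.1 ^ 2 + p.2 ^ 2))) with hG
  have hqc := continuous_quarticExp a
  have hGc : Continuous G := by
    simp only [hG]; fun_prop
  have hS : MeasurableSet {p : ℝ × ℝ | 0 < p.2} := measurableSet_lt measurable_const measurable_snd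
  -- Extension by zero allows polar coordinates on the whole plane; the indicator becomes that of `0
  -- < θ < π`.
  set F : ℝ × ℝ → ℂ := {p : ℝ × ℝ | 0 < p.2}.indicator G with hF
  have hFi : Integrable F := by
    have h1 := (integrableOn_pow_mul_exp_neg_quartic 3 ha).integrable_indicator measurableSet_Ioi
    have h2 := (integrable_exp_neg_quartic ha).mul_prod h1
    refine h2.mono' (hGc.aestronglyMeasurable.indicator hS)
      (Filter.Eventually.of_forall fun p ↦ ?_)
    by_cases hp : 0 < p.2
    · rw [hF, Set.indicator_of_mem (by exact hp), Set.indicator_of_mem (by exact hp), hG]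
      simp only
      rw [norm_mul, norm_exp_I_mul_ofReal, one_mul, norm_mul, norm_pow, Complex.norm_real,
        Real.norm_of_nonneg hp.le, ← mul_assoc, mul_comm _ (p.2 ^ 3), mul_assoc]
      exact mul_le_mul_of_nonneg_left (norm_quarticExp_sqrt_le ha.le _ _) (pow_nonneg hp.le _)
    · rw [hF, Set.indicator_of_notMem (by exact hp), Set.indicator_of_notMem (by exact hp)]
      simp
  have e1 : ∫ v : ℝ, ∫ s in Set.Ioi (0 : ℝ), Complex.exp (Complex.I * ((r * v : ℝ) : ℂ)) *
      ((s : ℂ) ^ 3 * quarticExp a (√(v ^ 2 + s ^ 2))) = ∫ p, F p := by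
    rw [Measure.volume_eq_prod, integral_prod _ (by rwa [← Measure.volume_eq_prod])]
    congr 1
    ext v
    rw [← integral_indicator measurableSet_Ioi]
    rfl
  set H : ℝ × ℝ → ℂ := fun p ↦ ((p.1 : ℂ) ^ 4 * quarticExp a p.1) *
    (Set.Ioo 0 Real.pi).indicator (fun θ ↦ ((Real.sin θ ^ 3 : ℝ) : ℂ) *
        Complex.exp (Complex.I * ((r * p.1 * Real.cos θ : ℝ) : ℂ))) p.2 with hH
  have e2 : ∫ p, F p = ∫ p in Set.Ioi (0 : ℝ) ×ˢ Set.Ioo (-Real.pi) Real.pi, H p := by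
    rw [← integral_comp_polarCoord_symm]
    refine setIntegral_congr_fun (measurableSet_Ioi.prod measurableSet_Ioo) fun p hp ↦ ?_
    obtain ⟨hp1 : 0 < p.1, hp2, hp3⟩ := hp
    simp only [polarCoord_symm_apply, hF, hH]
    have hsq : √((p.1 * Real.cos p.2) ^ 2 + (p.1 * Real.sin p.2) ^ 2) = p.1 := by
      rw [show (p.1 * Real.cos p.2) ^ 2 + (p.1 * Real.sin p.2) ^ 2 =
        p.1 ^ 2 * (Real.sin p.2 ^ 2 + Real.cos p.2 ^ 2) by ring, Real.sin_sq_add_cos_sq, mul_one,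
        Real.sqrt_sq hp1.le]
    by_cases h0 : 0 < p.2
    · have hs : 0 < Real.sin p.2 := Real.sin_pos_of_pos_of_lt_pi h0 hp3
      rw [Set.indicator_of_mem (by exact mul_pos hp1 hs),
        Set.indicator_of_mem (Set.mem_Ioo.2 ⟨h0, hp3⟩)]
      simp only [hG, hsq, Complex.real_smul]
      push_cast
      ring_nf
    · have hs : Real.sin p.2 ≤ 0 := Real.sin_nonpos_of_nonpos_of_neg_pi_le (not_lt.1 h0) hp2.le
      rw [Set.indicator_of_notMem, Set.indicator_of_notMem (fun h : p.2 ∈ Set.Ioo 0 Real.pi ↦ h0 h.1), smul_zero, mul_zero]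
      exact not_lt.2 (mul_nonpos_of_nonneg_of_nonpos hp1.le hs)
  have hHi : IntegrableOn H (Set.Ioi (0 : ℝ) ×ˢ Set.Ioo (-Real.pi) Real.pi) := by
    have h1 := integrableOn_pow_mul_exp_neg_quartic 4 ha
    have h2 : IntegrableOn (fun _ : ℝ ↦ (1 : ℝ)) (Set.Ioo (-Real.pi) Real.pi) :=
      integrableOn_const (by simp)
    have h3 := Integrable.mul_prod h1 h2
    rw [IntegrableOn, Measure.volume_eq_prod, ← Measure.prod_restrict]
    refine h3.mono' ?_ ?_
    · refine AEStronglyMeasurable.mul (Continuous.aestronglyMeasurable (by fun_prop)) ?_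
      have : (fun p : ℝ × ℝ ↦ (Set.Ioo 0 Real.pi).indicator (fun θ ↦ ((Real.sin θ ^ 3 : ℝ) : ℂ) *
        Complex.exp (Complex.I * ((r * p.1 * Real.cos θ : ℝ) : ℂ))) p.2) =
        ({p : ℝ × ℝ | p.2 ∈ Set.Ioo 0 Real.pi}).indicator (fun p ↦ ((Real.sin p.2 ^ 3 : ℝ) : ℂ) *
        Complex.exp (Complex.I * ((r * p.1 * Real.cos p.2 : ℝ) : ℂ))) := by
        ext p
        rfl
      rw [this]
      exact (Continuous.aestronglyMeasurable (by fun_prop)).indicator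
        (measurable_snd measurableSet_Ioo)
    · rw [Measure.prod_restrict]
      refine ae_restrict_of_forall_mem (measurableSet_Ioi.prod measurableSet_Ioo) fun p hp ↦ ?_
      have hp1 : 0 < p.1 := hp.1
      rw [norm_mul, norm_mul, norm_quarticExp, norm_pow, Complex.norm_real,
        Real.norm_of_nonneg hp1.le]
      refine mul_le_mul_of_nonneg_left ((norm_indicator_le_norm_self _ _).trans ?_)
        (by positivity)
      rw [norm_mul, norm_exp_I_mul_ofReal, mul_one, Complex.norm_real, norm_pow]
      exact pow_le_one₀ (norm_nonneg _) (Real.abs_sin_le_one _)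
  rw [e1, e2, Measure.volume_eq_prod, setIntegral_prod _ (by rwa [← Measure.volume_eq_prod])]
  refine setIntegral_congr_fun measurableSet_Ioi fun s _ ↦ ?_
  simp only [hH]
  rw [integral_const_mul, setIntegral_indicator measurableSet_Ioo,
    Set.inter_eq_self_of_subset_right (Set.Ioo_subset_Ioo_left (by linarith [Real.pi_pos])),
    ← integral_Ioc_eq_integral_Ioo, ← intervalIntegral.integral_of_le Real.pi_pos.le,
    oscPoly_eq_integral_sin]
  ring

/-- Radial form of the kernel: the spherical average of `e^{i y·ξ}` on `S⁴` has density `1 - u²`. -/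
theorem quarticKernel_eq_radial : ∃ c : ℝ, 0 ≤ c ∧ ∀ a : ℂ, 0 < a.re → ∀ y : E5,
    quarticKernel a y = c * ∫ s in Set.Ioi (0 : ℝ),
      (s : ℂ) ^ 4 * oscPoly (1 - Polynomial.X ^ 2) (‖y‖ * s) * quarticExp a s := by
  -- The constant is the area of `S³`, from polar coordinates in the four directions orthogonal to
  -- `y`.
  refine ⟨4 * volume.real (Metric.ball (0 : EuclideanSpace ℝ (Fin 4)) 1), by positivity,
    fun a ha y ↦ ?_⟩
  have hint : Integrable fun p : ℝ × EuclideanSpace ℝ (Fin 4) ↦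
      Complex.exp (Complex.I * ((‖y‖ * p.1 : ℝ) : ℂ)) *
        quarticExp a (√(p.1 ^ 2 + ‖p.2‖ ^ 2)) := by
    have h1 : Integrable fun w : EuclideanSpace ℝ (Fin 4) ↦ Real.exp (-a.re * ‖w‖ ^ 4) := by
      rw [integrable_fun_norm_addHaar volume (f := fun s ↦ Real.exp (-a.re * s ^ 4))]
      simpa using integrableOn_pow_mul_exp_neg_quartic 3 ha
    have hqc := continuous_quarticExp a
    refine ((integrable_exp_neg_quartic ha).mul_prod h1).mono'
      (Continuous.aestronglyMeasurable (by fun_prop)) (Filter.Eventually.of_forall fun p ↦ ?_)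
    rw [norm_mul, norm_exp_I_mul_ofReal, one_mul]
    exact norm_quarticExp_sqrt_le ha.le _ _
  rw [quarticKernel, integral_E5_eq_integral_prod, Measure.volume_eq_prod,
    integral_prod _ (by rwa [← Measure.volume_eq_prod]), ← integral_half_plane_eq_radial ha,
    ← integral_const_mul]
  congr 1
  ext v
  simp only
  rw [integral_const_mul, integral_const_mul,
    integral_fun_norm_addHaar volume (fun s ↦ quarticExp a (√(v ^ 2 + s ^ 2)))]
  simp
  ring

theorem exists_quadDecay_oscPoly (p : Polynomial ℂ) (h1 : p.eval 1 = 0) (h2 : p.eval (-1) = 0) :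
    ∃ D, QuadDecay D (oscPoly p) (oscPoly (Polynomial.C Complex.I * Polynomial.X * p))
      (oscPoly (Polynomial.C Complex.I * Polynomial.X *
        (Polynomial.C Complex.I * Polynomial.X * p))) := by
  obtain ⟨D₀, hD₀, h₀⟩ := oscPoly_decay p h1 h2
  obtain ⟨D₁, hD₁, h₁⟩ := oscPoly_decay (Polynomial.C Complex.I * Polynomial.X * p)
    (by simp [h1]) (by simp [h2])
  obtain ⟨D₂, hD₂, h₂⟩ := oscPoly_decay (Polynomial.C Complex.I * Polynomial.X *
    (Polynomial.C Complex.I * Polynomial.X * p)) (by simp [h1]) (by simp [h2])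
  refine ⟨D₀ + D₁ + D₂, hasDerivAt_oscPoly _, hasDerivAt_oscPoly _,
    continuous_iff_continuousAt.2 fun x ↦ (hasDerivAt_oscPoly _ x).continuousAt,
    fun x hx ↦ ?_, fun x hx ↦ ?_, fun x hx ↦ ?_⟩
  · linarith [h₀ x hx]
  · linarith [h₁ x hx]
  · linarith [h₂ x hx]

theorem hasDerivAt_radial {a : ℂ} (ha : 0 < a.re) (p : Polynomial ℂ) (r : ℝ) :
    HasDerivAt (fun r : ℝ ↦ ∫ s in Set.Ioi (0 : ℝ), (s : ℂ) ^ 4 * oscPoly p (r * s) *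
      quarticExp a s)
      (∫ s in Set.Ioi (0 : ℝ), (s : ℂ) ^ 5 *
        oscPoly (Polynomial.C Complex.I * Polynomial.X * p) (r * s) * quarticExp a s) r := by
  have hc : ∀ q, Continuous (oscPoly q) := fun q ↦
    continuous_iff_continuousAt.2 fun x ↦ (hasDerivAt_oscPoly _ x).continuousAt
  have hqc := continuous_quarticExp a
  obtain ⟨D₀, hD₀, h₀⟩ := oscPoly_bounded p
  obtain ⟨D₁, hD₁, h₁⟩ := oscPoly_bounded (Polynomial.C Complex.I * Polynomial.X * p)
  refine (hasDerivAt_integral_of_dominated_loc_of_deriv_le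
    (F := fun (r s : ℝ) ↦ (s : ℂ) ^ 4 * oscPoly p (r * s) * quarticExp a s)
    (F' := fun (r s : ℝ) ↦ (s : ℂ) ^ 5 *
        oscPoly (Polynomial.C Complex.I * Polynomial.X * p) (r * s) * quarticExp a s)
    (bound := fun s ↦ D₁ * (s ^ 5 * Real.exp (-a.re * s ^ 4)))
    (s := Set.univ) Filter.univ_mem ?_ ?_ ?_ ?_ ?_ ?_).2
  · refine Filter.Eventually.of_forall fun r ↦ Continuous.aestronglyMeasurable ?_
    have := hc p
    fun_prop
  · have := hc p
    refine integrableOn_mul_quarticExp ha le_rfl 4 (D := D₀)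
      (Continuous.continuousOn (by fun_prop)) fun s hs ↦ ?_
    rw [norm_mul, norm_pow, Complex.norm_real, Real.norm_of_nonneg hs.le, mul_comm D₀]
    exact mul_le_mul_of_nonneg_left (h₀ _) (pow_nonneg hs.le _)
  · have := hc (Polynomial.C Complex.I * Polynomial.X * p)
    exact Continuous.aestronglyMeasurable (by fun_prop)
  · refine ae_restrict_of_forall_mem measurableSet_Ioi fun s hs r _ ↦ ?_
    have hs0 : 0 < s := hs
    rw [norm_mul, norm_mul, norm_pow, Complex.norm_real, Real.norm_of_nonneg hs0.le,
      norm_quarticExp, ← mul_assoc, mul_comm D₁]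
    have := h₁ (r * s)
    gcongr
  · exact (integrableOn_pow_mul_exp_neg_quartic 5 ha).const_mul D₁
  · refine Filter.Eventually.of_forall fun s r _ ↦ ?_
    have h := hasDerivAt_comp_const_mul (r := s) (s := r) (hasDerivAt_oscPoly p (s * r))
    simp only [mul_comm s] at h
    refine ((h.const_mul ((s : ℂ) ^ 4)).mul_const (quarticExp a s)).congr_deriv ?_
    ring

/-- One constant serves all `a` with `‖a‖ ≥ 1`. Boundedness, decay and the Lipschitz bound come from
`radial_four`, `radial_four_decay` with `A = ‖y‖^{1/3}`, and `radial_five` applied to the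
`r`-derivative. -/
theorem quarticKernel_bounds : ∃ C : ℝ, 0 ≤ C ∧ ∀ a : ℂ, 0 < a.re → 1 ≤ ‖a‖ →
    (∀ y, ‖quarticKernel a y‖ ≤ C) ∧
    (∀ y, ‖y‖ ^ (1 / 3 : ℝ) * ‖quarticKernel a y‖ ≤ C) ∧
    (∀ y z, ‖quarticKernel a y - quarticKernel a z‖ ≤ C * ‖y - z‖) := by
  obtain ⟨c, hc0, hc⟩ := quarticKernel_eq_radial
  obtain ⟨D, hD⟩ := exists_quadDecay_oscPoly (1 - Polynomial.X ^ 2) (by simp) (by simp)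
  obtain ⟨D', hD'⟩ := exists_quadDecay_oscPoly
    (Polynomial.C Complex.I * Polynomial.X * (1 - Polynomial.X ^ 2)) (by simp) (by simp)
  have hD0 := hD.nonneg
  have hD0' := hD'.nonneg
  have hmono : c * (9 * D) ≤ c * (9 * D + 11 * D') := by gcongr; linarith
  have hn : ∀ z : ℂ, ‖(c : ℂ) * z‖ = c * ‖z‖ := fun z ↦ by
    rw [norm_mul, Complex.norm_real, Real.norm_of_nonneg hc0]
  refine ⟨c * (9 * D + 11 * D'), by positivity, fun a ha ha1 ↦ ?_⟩
  have hb : ∀ y, ‖quarticKernel a y‖ ≤ c * (9 * D) := fun y ↦ by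
    rw [hc a ha, hn]
    exact mul_le_mul_of_nonneg_left (hD.radial_four ha ha1 (norm_nonneg y)) hc0
  refine ⟨fun y ↦ (hb y).trans hmono, fun y ↦ ?_, fun y z ↦ ?_⟩
  · rcases le_total ‖y‖ 1 with hy | hy
    · exact (mul_le_of_le_one_left (norm_nonneg _)
        (Real.rpow_le_one (norm_nonneg y) hy (by norm_num))).trans ((hb y).trans hmono)
    · have hA : 1 ≤ ‖y‖ ^ (1 / 3 : ℝ) := Real.one_le_rpow hy (by norm_num)
      have hA3 : (‖y‖ ^ (1 / 3 : ℝ)) ^ 3 = ‖y‖ := by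
        rw [← Real.rpow_natCast, ← Real.rpow_mul (norm_nonneg y)]
        norm_num
      have h := hD.radial_four_decay ha ha1 hA
      rw [hA3] at h
      rw [hc a ha, hn, mul_left_comm]
      exact (mul_le_mul_of_nonneg_left h hc0).trans hmono
  · have hL := (convex_Ici (0 : ℝ)).norm_image_sub_le_of_norm_hasDerivWithin_le (C := 11 * D')
      (fun r _ ↦ (hasDerivAt_radial ha (1 - Polynomial.X ^ 2) r).hasDerivWithinAt)
      (fun r hr ↦ hD'.radial_five ha ha1 hr)
      (x := ‖z‖) (y := ‖y‖) (norm_nonneg z) (norm_nonneg y)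
    rw [hc a ha, hc a ha, ← mul_sub, hn, mul_assoc]
    refine mul_le_mul_of_nonneg_left (hL.trans ?_) hc0
    rw [Real.norm_eq_abs]
    refine mul_le_mul ?_ (abs_norm_sub_norm_le y z) (abs_nonneg _) (by positivity)
    linarith

/-! ### The limit kernel. -/

/-- Boundedness, decay and Lipschitz continuity of a kernel on `ℝ⁵`. -/
structure KernelBounds (C : ℝ) (K : E5 → ℂ) : Prop where
  bound : ∀ y, ‖K y‖ ≤ C
  decay : ∀ y, ‖y‖ ^ (1 / 3 : ℝ) * ‖K y‖ ≤ C
  lipschitz : ∀ y z, ‖K y - K z‖ ≤ C * ‖y - z‖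

/-- The kernel of `e^{iΔ²}` as the limit of regularized kernels along a sequence. -/
theorem exists_limit_quarticKernel : ∃ (C : ℝ) (K : E5 → ℂ) (ε : ℕ → ℝ), 0 ≤ C ∧
    KernelBounds C K ∧ (∀ n, 0 < ε n) ∧ Filter.Tendsto ε Filter.atTop (nhds 0) ∧
    (∀ n y, ‖quarticKernel (ε n - Complex.I) y‖ ≤ C) ∧
    ∀ y, Filter.Tendsto (fun n ↦ quarticKernel (ε n - Complex.I) y) Filter.atTop
      (nhds (K y)) := by
  obtain ⟨C, hC0, hC⟩ := quarticKernel_bounds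
  set Q : ℕ → E5 → ℂ := fun n ↦ quarticKernel (((1 / ((n : ℝ) + 1) : ℝ) : ℂ) - Complex.I) with hQ
  have hQb : ∀ n, (∀ y, ‖Q n y‖ ≤ C) ∧ (∀ y, ‖y‖ ^ (1 / 3 : ℝ) * ‖Q n y‖ ≤ C) ∧
      (∀ y z, ‖Q n y - Q n z‖ ≤ C * ‖y - z‖) := by
    intro n
    refine hC _ ?_ ?_
    · rw [Complex.sub_re, Complex.I_re, Complex.ofReal_re, sub_zero]; positivity
    · refine le_trans ?_ (Complex.abs_im_le_norm _)
      rw [Complex.sub_im, Complex.I_im, Complex.ofReal_im]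
      norm_num
  -- Compactness of a countable product of discs gives one subsequence converging at every point of
  -- a dense sequence; no convergence of the oscillatory integral itself is needed.
  obtain ⟨k, -, φ, hφ, hlim⟩ := (isCompact_univ_pi fun _ : ℕ ↦
    isCompact_closedBall (0 : ℂ) C).tendsto_subseq
    (x := fun n j ↦ Q n (TopologicalSpace.denseSeq E5 j)) (fun n j _ ↦ by
      rw [mem_closedBall_zero_iff]; exact (hQb n).1 _)
  rw [tendsto_pi_nhds] at hlim
  -- The common Lipschitz constant carries convergence from the dense sequence to every point, with
  -- three errors of size `e / 3`.
  have hcauchy : ∀ y, CauchySeq fun n ↦ Q (φ n) y := by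
    intro y
    rw [Metric.cauchySeq_iff']
    intro e he
    obtain ⟨j, hj⟩ := (TopologicalSpace.denseRange_denseSeq E5).exists_dist_lt y
      (show 0 < e / (3 * (C + 1)) by positivity)
    obtain ⟨N, hN⟩ := Metric.cauchySeq_iff'.1 (hlim j).cauchySeq (e / 3) (by positivity)
    refine ⟨N, fun n hn ↦ ?_⟩
    have hj' : C * ‖y - TopologicalSpace.denseSeq E5 j‖ < e / 3 := by
      rw [dist_eq_norm] at hj
      rw [lt_div_iff₀ (by positivity)] at hj
      nlinarith [norm_nonneg (y - TopologicalSpace.denseSeq E5 j)]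
    have h1 := (hQb (φ n)).2.2 y (TopologicalSpace.denseSeq E5 j)
    have h2 := (hQb (φ N)).2.2 y (TopologicalSpace.denseSeq E5 j)
    have h3 := hN n hn
    simp only [Function.comp, dist_eq_norm] at h3
    rw [dist_eq_norm]
    have h4 : Q (φ n) y - Q (φ N) y =
      (Q (φ n) y - Q (φ n) (TopologicalSpace.denseSeq E5 j)) +
      (Q (φ n) (TopologicalSpace.denseSeq E5 j) - Q (φ N) (TopologicalSpace.denseSeq E5 j)) -
      (Q (φ N) y - Q (φ N) (TopologicalSpace.denseSeq E5 j)) := by ring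
    rw [h4]
    refine (norm_sub_le _ _).trans_lt ?_
    have := norm_add_le (Q (φ n) y - Q (φ n) (TopologicalSpace.denseSeq E5 j))
      (Q (φ n) (TopologicalSpace.denseSeq E5 j) - Q (φ N) (TopologicalSpace.denseSeq E5 j))
    linarith
  choose K hK using fun y ↦ cauchySeq_tendsto_of_complete (hcauchy y)
  refine ⟨C, K, fun n ↦ 1 / ((φ n : ℝ) + 1), hC0, ⟨fun y ↦ ?_, fun y ↦ ?_, fun y z ↦ ?_⟩,
    fun n ↦ by positivity, ?_, fun n y ↦ (hQb (φ n)).1 y, hK⟩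
  · exact le_of_tendsto (hK y).norm (Filter.Eventually.of_forall fun n ↦ (hQb (φ n)).1 y)
  · exact le_of_tendsto ((hK y).norm.const_mul _)
      (Filter.Eventually.of_forall fun n ↦ (hQb (φ n)).2.1 y)
  · exact le_of_tendsto ((hK y).sub (hK z)).norm
      (Filter.Eventually.of_forall fun n ↦ (hQb (φ n)).2.2 y z)
  · exact (tendsto_one_div_add_atTop_nhds_zero_nat (𝕜 := ℝ)).comp hφ.tendsto_atTop

/-! ### The Fourier transform on `L¹ ∩ L²`, compared through Schwartz test functions. -/

/-- Locally integrable functions with equal integrals against Schwartz functions are equal. -/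
theorem ae_eq_of_integral_schwartz_mul {f g : E5 → ℂ} (hf : LocallyIntegrable f)
    (hg : LocallyIntegrable g) (h : ∀ φ : 𝓢(E5, ℂ), ∫ x, φ x * f x = ∫ x, φ x * g x) :
    f =ᵐ[volume] g := by
  refine ae_eq_of_integral_contDiff_smul_eq hf hg fun χ hχ hχc ↦ ?_
  have hg₁ : HasCompactSupport (Complex.ofRealCLM ∘ χ) := hχc.comp_left rfl
  have hg₂ : ContDiff ℝ (⊤ : ℕ∞) (Complex.ofRealCLM ∘ χ) := by fun_prop
  exact h (hg₁.toSchwartzMap hg₂)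

theorem integral_fourier_mul_eq_mul_fourier {f g : E5 → ℂ} (hf : Integrable f)
    (hg : Integrable g) : ∫ x, 𝓕 f x * g x = ∫ x, f x * 𝓕 g x := by
  have h := VectorFourier.integral_fourierIntegral_smul_eq_flip (L := innerₗ E5)
    Real.continuous_fourierChar continuous_inner hf hg
  simp only [smul_eq_mul, flip_innerₗ] at h
  exact h

theorem integral_fourierInv_mul_eq_mul_fourierInv {f g : E5 → ℂ} (hf : Integrable f)
    (hg : Integrable g) : ∫ x, 𝓕⁻ f x * g x = ∫ x, f x * 𝓕⁻ g x := by
  rw [Real.fourierInv_eq_fourier_comp_neg g, ← integral_fourier_mul_eq_mul_fourier hf hg.comp_neg]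
  rw [← integral_neg_eq_self (fun x ↦ 𝓕 f x * g (-x))]
  simp [Real.fourierInv_eq_fourier_neg]

theorem integral_schwartz_mul_fourier_L2 (f : L2E5) (φ : 𝓢(E5, ℂ)) :
    ∫ x, φ x * (𝓕 f : L2E5) x = ∫ x, (𝓕 φ) x * f x := by
  have h := congrArg (fun T : 𝓢'(E5, ℂ) ↦ T φ) (Lp.fourier_toTemperedDistribution_eq f)
  simp only [TemperedDistribution.fourier_apply, Lp.toTemperedDistribution_apply,
    smul_eq_mul] at h
  exact h.symm

theorem integral_schwartz_mul_fourierInv_L2 (f : L2E5) (φ : 𝓢(E5, ℂ)) :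
    ∫ x, φ x * (𝓕⁻ f : L2E5) x = ∫ x, (𝓕⁻ φ) x * f x := by
  have h := congrArg (fun T : 𝓢'(E5, ℂ) ↦ T φ) (Lp.fourierInv_toTemperedDistribution_eq f)
  simp only [TemperedDistribution.fourierInv_apply, Lp.toTemperedDistribution_apply,
    smul_eq_mul] at h
  exact h.symm

theorem locallyIntegrable_L2 (f : L2E5) : LocallyIntegrable f :=
  (Lp.memLp f).locallyIntegrable (by norm_num)

theorem continuous_fourier_of_integrable {f : E5 → ℂ} (hf : Integrable f) : Continuous (𝓕 f) :=
  VectorFourier.fourierIntegral_continuous (L := innerₗ E5) Real.continuous_fourierChar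
    continuous_inner hf

/-- On `L¹ ∩ L²` the Plancherel transform is the Fourier integral. -/
theorem fourier_L2_ae_eq {f : L2E5} (hf : Integrable f) :
    (𝓕 f : L2E5) =ᵐ[volume] 𝓕 (f : E5 → ℂ) := by
  refine ae_eq_of_integral_schwartz_mul (locallyIntegrable_L2 _)
    (continuous_fourier_of_integrable hf).locallyIntegrable fun φ ↦ ?_
  rw [integral_schwartz_mul_fourier_L2, SchwartzMap.fourier_coe,
    integral_fourier_mul_eq_mul_fourier φ.integrable hf]

theorem ae_comp_smul {r : ℝ} (hr : r ≠ 0) {P : E5 → Prop} (h : ∀ᵐ x : E5, P x) :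
    ∀ᵐ x : E5, P (r • x) := by
  have hq : Measure.QuasiMeasurePreserving (fun x : E5 ↦ r • x) volume volume := by
    refine ⟨measurable_const_smul r, ?_⟩
    rw [Measure.map_addHaar_smul volume hr]
    exact Measure.smul_absolutelyContinuous
  exact hq.ae h

theorem memLp_comp_smul {r : ℝ} (hr : r ≠ 0) {p : ℝ≥0∞} {f : E5 → ℂ} (hf : MemLp f p) :
    MemLp (fun x : E5 ↦ f (r • x)) p := by
  have h1 : MemLp f p (Measure.map (fun x : E5 ↦ r • x) volume) := by
    rw [Measure.map_addHaar_smul volume hr]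
    exact hf.smul_measure ENNReal.ofReal_ne_top
  exact (memLp_map_measure_iff h1.1 (measurable_const_smul r).aemeasurable).1 h1

/-- The unitary Fourier integral `(2π)^{-5/2} ∫ e^{-i z·ξ} f(z) dz`. -/
noncomputable def fourierRep (f : E5 → ℂ) (ξ : E5) : ℂ :=
  (((2 * Real.pi) ^ (-(5 / 2 : ℝ)) : ℝ) : ℂ) *
    ∫ z, Complex.exp (Complex.I * ((-inner ℝ z ξ : ℝ) : ℂ)) * f z

theorem fourierRep_eq (f : E5 → ℂ) (ξ : E5) :
    fourierRep f ξ = (((2 * Real.pi) ^ (-(5 / 2 : ℝ)) : ℝ) : ℂ) * 𝓕 f ((2 * Real.pi)⁻¹ • ξ) := by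
  rw [fourierRep, Real.fourier_eq']
  congr 2
  ext z
  have : -2 * Real.pi * inner ℝ z ((2 * Real.pi)⁻¹ • ξ) = -inner ℝ z ξ := by
    rw [inner_smul_right]
    have := Real.pi_pos.ne'
    field_simp
  rw [this, smul_eq_mul, mul_comm Complex.I]

theorem continuous_fourierRep {f : E5 → ℂ} (hf : Integrable f) : Continuous (fourierRep f) := by
  have h := continuous_fourier_of_integrable hf
  have : fourierRep f = fun ξ ↦ (((2 * Real.pi) ^ (-(5 / 2 : ℝ)) : ℝ) : ℂ) *
      𝓕 f ((2 * Real.pi)⁻¹ • ξ) := funext (fourierRep_eq f)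
  rw [this]
  exact continuous_const.mul (h.comp (continuous_const_smul _))

theorem hat_ae (f : L2E5) : ∀ᵐ ξ, hat f ξ =
    (((2 * Real.pi) ^ (-(5 / 2 : ℝ)) : ℝ) : ℂ) * (𝓕 f : L2E5) ((2 * Real.pi)⁻¹ • ξ) :=
  MemLp.coeFn_toLp _

theorem fourierRep_ae_eq_hat {f : L2E5} (hf : Integrable f) :
    fourierRep f =ᵐ[volume] hat f := by
  have h := ae_comp_smul (r := (2 * Real.pi)⁻¹) (by positivity) (fourier_L2_ae_eq hf)
  filter_upwards [h, hat_ae f] with ξ h1 h2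
  rw [h2, fourierRep_eq, h1]

/-! ### From `f̂ ∈ H³` to a weighted `L¹` bound on `f`. -/

/-- The dilation by `2π` absorbs the normalization of `hat`, and the sign appears because two
Fourier transforms compose to a reflection. Pairing `𝓕 ψ` with `hat f` thus amounts to pairing `𝓕⁻
χ` with `𝓕 f`. -/
theorem fourierInv_schwartz_dilate (χ : 𝓢(E5, ℂ)) : ∃ ψ : 𝓢(E5, ℂ),
    (∀ x, ψ x = (((2 * Real.pi) ^ 5 : ℝ) : ℂ) * χ (-(2 * Real.pi) • x)) ∧
    ∀ ξ, (𝓕 ψ) ξ = (𝓕⁻ χ) ((2 * Real.pi)⁻¹ • ξ) := by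
  have hr : (-(2 * Real.pi)) ≠ 0 := neg_ne_zero.2 (by positivity)
  refine ⟨(((2 * Real.pi) ^ 5 : ℝ) : ℂ) • SchwartzMap.compCLMOfContinuousLinearEquiv ℂ
    (ContinuousLinearEquiv.smulLeft (Units.mk0 (-(2 * Real.pi)) hr)) χ, fun x ↦ rfl,
    fun ξ ↦ ?_⟩
  rw [SchwartzMap.fourier_coe, SchwartzMap.fourierInv_coe, Real.fourier_eq', Real.fourierInv_eq']
  have h := Measure.integral_comp_smul (volume : Measure E5)
    (fun v ↦ Complex.exp ((2 * Real.pi * inner ℝ v ((2 * Real.pi)⁻¹ • ξ) : ℝ) * Complex.I) • χ v)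
    (-(2 * Real.pi))
  have hfr : Module.finrank ℝ E5 = 5 := by simp [E5]
  rw [hfr] at h
  have h5 : |((-(2 * Real.pi)) ^ 5)⁻¹| = ((2 * Real.pi) ^ 5)⁻¹ := by
    rw [abs_inv, abs_pow, abs_neg, abs_of_pos (by positivity)]
  rw [h5] at h
  have h6 : ∀ v : E5, Complex.exp ((-2 * Real.pi * inner ℝ v ξ : ℝ) * Complex.I) •
      ((((2 * Real.pi) ^ 5 : ℝ) : ℂ) * χ (-(2 * Real.pi) • v)) = (((2 * Real.pi) ^ 5 : ℝ) : ℂ) *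
      (Complex.exp ((2 * Real.pi * inner ℝ (-(2 * Real.pi) • v) ((2 * Real.pi)⁻¹ • ξ) : ℝ) *
        Complex.I) • χ (-(2 * Real.pi) • v)) := by
    intro v
    have : 2 * Real.pi * inner ℝ (-(2 * Real.pi) • v) ((2 * Real.pi)⁻¹ • ξ) =
        -2 * Real.pi * inner ℝ v ξ := by
      rw [inner_smul_right, inner_smul_left]
      have := Real.pi_pos.ne'
      simp
      field_simp
    rw [this, smul_eq_mul, smul_eq_mul]
    ring
  refine (integral_congr_ae (Filter.Eventually.of_forall h6)).trans ?_
  rw [integral_const_mul, h, Complex.real_smul, ← mul_assoc, ← Complex.ofReal_mul,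
    mul_inv_cancel₀ (by positivity), Complex.ofReal_one, one_mul]

theorem integral_comp_inv_two_pi_smul (F : E5 → ℂ) :
    ∫ ξ, F ((2 * Real.pi)⁻¹ • ξ) = (((2 * Real.pi) ^ 5 : ℝ) : ℂ) * ∫ η, F η := by
  have h := Measure.integral_comp_smul (volume : Measure E5) F (2 * Real.pi)⁻¹
  have hfr : Module.finrank ℝ E5 = 5 := by simp [E5]
  have h5 : |(((2 * Real.pi)⁻¹) ^ 5)⁻¹| = (2 * Real.pi) ^ 5 := by
    rw [inv_pow, inv_inv, abs_of_pos (by positivity)]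
  rw [h, hfr, h5, Complex.real_smul]

theorem integral_comp_neg_two_pi_smul (F : E5 → ℂ) :
    (((2 * Real.pi) ^ 5 : ℝ) : ℂ) * ∫ x, F (-(2 * Real.pi) • x) = ∫ z, F z := by
  have h := Measure.integral_comp_smul (volume : Measure E5) F (-(2 * Real.pi))
  have hfr : Module.finrank ℝ E5 = 5 := by simp [E5]
  have h5 : |((-(2 * Real.pi)) ^ 5)⁻¹| = ((2 * Real.pi) ^ 5)⁻¹ := by
    rw [abs_inv, abs_pow, abs_neg, abs_of_pos (by positivity)]
  rw [h, hfr, h5, Complex.real_smul, ← mul_assoc, ← Complex.ofReal_mul,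
    mul_inv_cancel₀ (by positivity), Complex.ofReal_one, one_mul]

/-- A function whose Fourier transform is in `H³` is an `L²` function divided by a cubic weight. -/
theorem exists_weighted_L2_of_memSobolev (f : L2E5) (hf : MemSobolev 3 2 (hat f : 𝓢'(E5, ℂ))) :
    ∃ G : L2E5, ‖G‖ = sobolevNorm 3 (hat f : 𝓢'(E5, ℂ)) hf ∧ ∀ᵐ z : E5, f z =
      (((2 * Real.pi) ^ (-(5 / 2 : ℝ)) : ℝ) : ℂ) *
        (((1 + ‖(-(2 * Real.pi)⁻¹ • z : E5)‖ ^ 2) ^ (-(3 / 2) : ℝ) : ℝ) : ℂ) *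
          G (-(2 * Real.pi)⁻¹ • z) := by
  set g : L2E5 := hf.choose with hg
  have hgs : besselPotential E5 ℂ 3 (hat f : 𝓢'(E5, ℂ)) = g := hf.choose_spec
  refine ⟨𝓕 g, Lp.norm_fourier_eq g, ?_⟩
  have hr : (-(2 * Real.pi)⁻¹) ≠ 0 := neg_ne_zero.2 (by positivity)
  set σ : E5 → ℂ := fun x ↦ (((1 + ‖x‖ ^ 2) ^ ((3 : ℝ) / 2) : ℝ) : ℂ) with hσ
  set σ' : E5 → ℂ := fun x ↦ (((1 + ‖x‖ ^ 2) ^ (-(3 / 2) : ℝ) : ℝ) : ℂ) with hσ'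
  have hσt : σ.HasTemperateGrowth := by fun_prop
  have hσt' : σ'.HasTemperateGrowth := by fun_prop
  have hσσ : ∀ x, σ x * σ' x = 1 := by
    intro x
    simp only [hσ, hσ']
    rw [← Complex.ofReal_mul, Real.rpow_neg (by positivity), mul_inv_cancel₀ (by positivity),
      Complex.ofReal_one]
  set c : ℂ := (((2 * Real.pi) ^ (-(5 / 2 : ℝ)) : ℝ) : ℂ) with hc
  have hcc : c * c * (((2 * Real.pi) ^ 5 : ℝ) : ℂ) = 1 := by
    rw [hc, ← Complex.ofReal_mul, ← Complex.ofReal_mul, ← Real.rpow_add (by positivity),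
      ← Real.rpow_natCast, ← Real.rpow_add (by positivity)]
    norm_num
  have hbes := congrArg 𝓕 hgs
  rw [fourier_besselPotential_eq_smulLeftCLM_fourier_apply, Lp.fourier_toTemperedDistribution_eq,
    Lp.fourier_toTemperedDistribution_eq] at hbes
  have hGm : MemLp (fun x : E5 ↦ c * σ' x * (𝓕 g : L2E5) x) 2 := by
    refine (Lp.memLp (𝓕 g)).of_le_mul (c := ‖c‖)
      ((continuous_const.mul hσt'.1.continuous).aestronglyMeasurable.mul
        (Lp.aestronglyMeasurable _)) (Filter.Eventually.of_forall fun x ↦ ?_)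
    rw [norm_mul, norm_mul]
    refine mul_le_mul_of_nonneg_right (mul_le_of_le_one_right (norm_nonneg _) ?_) (norm_nonneg _)
    simp only [hσ']
    rw [Complex.norm_real, Real.norm_of_nonneg (by positivity)]
    exact Real.rpow_le_one_of_one_le_of_nonpos (by nlinarith [sq_nonneg ‖x‖]) (by norm_num)
  refine ae_eq_of_integral_schwartz_mul (locallyIntegrable_L2 f)
    ((memLp_comp_smul hr hGm).locallyIntegrable (by norm_num)) fun χ ↦ ?_
  obtain ⟨ψ, hψ, hψF⟩ := fourierInv_schwartz_dilate χ
  -- move to the Fourier side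
  have e1 : ∫ x, χ x * f x = ∫ η, (𝓕⁻ χ : 𝓢(E5, ℂ)) η * (𝓕 f : L2E5) η := by
    rw [integral_schwartz_mul_fourier_L2, FourierTransform.fourier_fourierInv_eq]
  have e2 : ∫ ξ, (𝓕 ψ : 𝓢(E5, ℂ)) ξ * hat f ξ =
      c * ((((2 * Real.pi) ^ 5 : ℝ) : ℂ) * ∫ η, (𝓕⁻ χ : 𝓢(E5, ℂ)) η * (𝓕 f : L2E5) η) := by
    rw [← integral_comp_inv_two_pi_smul (fun η ↦ (𝓕⁻ χ : 𝓢(E5, ℂ)) η * (𝓕 f : L2E5) η),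
      ← integral_const_mul]
    refine integral_congr_ae ?_
    filter_upwards [hat_ae f] with ξ h
    rw [h, hψF]
    ring
  -- use the Sobolev hypothesis
  have e3 : ∫ ξ, (𝓕 ψ : 𝓢(E5, ℂ)) ξ * hat f ξ = ∫ x, σ' x * ψ x * (𝓕 g : L2E5) x := by
    have h := congrArg (fun T : 𝓢'(E5, ℂ) ↦ T (SchwartzMap.smulLeftCLM ℂ σ' ψ)) hbes
    simp only [TemperedDistribution.smulLeftCLM_apply_apply] at h
    rw [SchwartzMap.smulLeftCLM_smulLeftCLM_apply hσt hσt'] at h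
    -- Testing against `σ'ψ` removes the Bessel weight from `𝓕 (hat f)` and places its inverse on `𝓕
    -- g`.
    have h1 : SchwartzMap.smulLeftCLM ℂ (σ * σ') ψ = ψ := by
      ext x
      rw [SchwartzMap.smulLeftCLM_apply_apply (hσt.mul hσt')]
      simp [hσσ]
    rw [h1, Lp.toTemperedDistribution_apply, Lp.toTemperedDistribution_apply] at h
    simp only [smul_eq_mul, SchwartzMap.smulLeftCLM_apply_apply hσt'] at h
    rw [← integral_schwartz_mul_fourier_L2, h]
  have e4 : ∫ x, σ' x * ψ x * (𝓕 g : L2E5) x = (((2 * Real.pi) ^ 5 : ℝ) : ℂ) *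
      ∫ x, χ (-(2 * Real.pi) • x) * (σ' x * (𝓕 g : L2E5) x) := by
    rw [← integral_const_mul]
    congr 1
    ext x
    rw [hψ]
    ring
  have e5 := integral_comp_neg_two_pi_smul
    (fun z ↦ χ z * (σ' (-(2 * Real.pi)⁻¹ • z) * (𝓕 g : L2E5) (-(2 * Real.pi)⁻¹ • z)))
  have e6 : ∀ x : E5, (-(2 * Real.pi)⁻¹ • (-(2 * Real.pi) • x)) = x := by
    intro x
    rw [smul_smul, neg_mul_neg, inv_mul_cancel₀ (by positivity), one_smul]
  simp only [e6] at e5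
  have e7 : ∫ z, χ z * (c * σ' (-(2 * Real.pi)⁻¹ • z) * (𝓕 g : L2E5) (-(2 * Real.pi)⁻¹ • z)) =
      c * ∫ z, χ z * (σ' (-(2 * Real.pi)⁻¹ • z) * (𝓕 g : L2E5) (-(2 * Real.pi)⁻¹ • z)) := by
    rw [← integral_const_mul]
    congr 1
    ext x
    ring
  refine Eq.trans ?_ e7.symm
  rw [← e5, ← e4, ← e3, e2, e1]
  linear_combination (-∫ η, (𝓕⁻ χ : 𝓢(E5, ℂ)) η * (𝓕 f : L2E5) η) * hcc

/-- The integrand is `min(1, τs)² s⁻²`, where `s⁴` is the radial density in dimension five. It is at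
most `τ²` up to `s = 1/τ` and at most `s⁻²` beyond, and each range contributes at most `τ`. -/
theorem radial_weight_bound {τ : ℝ} (hτ : 0 < τ) :
    IntegrableOn (fun s : ℝ ↦ s ^ 4 • (min 1 (τ * s) * (s ^ 3)⁻¹) ^ 2) (Set.Ioi 0) ∧
      ∫ s in Set.Ioi (0 : ℝ), s ^ 4 • (min 1 (τ * s) * (s ^ 3)⁻¹) ^ 2 ≤ 2 * τ := by
  have hτ' : 0 < τ⁻¹ := inv_pos.2 hτ
  set h : ℝ → ℝ := fun s ↦ s ^ 4 • (min 1 (τ * s) * (s ^ 3)⁻¹) ^ 2 with hh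
  have hm : Measurable h := by
    simp only [hh, smul_eq_mul]
    fun_prop
  have hn : ∀ s, 0 ≤ h s := fun s ↦ by
    simp only [hh, smul_eq_mul]; positivity
  have h1 : ∀ s ∈ Set.Ioc 0 τ⁻¹, ‖h s‖ ≤ τ ^ 2 := by
    intro s hs
    have hs0 := hs.1
    rw [Real.norm_of_nonneg (hn s)]
    simp only [hh, smul_eq_mul]
    have : min 1 (τ * s) ^ 2 ≤ (τ * s) ^ 2 := by
      have : 0 ≤ min 1 (τ * s) := by positivity
      gcongr
      exact min_le_right _ _
    calc s ^ 4 * (min 1 (τ * s) * (s ^ 3)⁻¹) ^ 2 = min 1 (τ * s) ^ 2 * (s ^ 2)⁻¹ := by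
          field_simp
      _ ≤ (τ * s) ^ 2 * (s ^ 2)⁻¹ := by gcongr
      _ = τ ^ 2 := by field_simp
  have h2 : ∀ s ∈ Set.Ioi τ⁻¹, ‖h s‖ ≤ s ^ (-2 : ℝ) := by
    intro s hs
    have hs0 : 0 < s := hτ'.trans hs
    rw [Real.norm_of_nonneg (hn s)]
    simp only [hh, smul_eq_mul]
    have : min 1 (τ * s) ^ 2 ≤ 1 := by
      have : 0 ≤ min 1 (τ * s) := by positivity
      exact pow_le_one₀ this (min_le_left _ _)
    calc s ^ 4 * (min 1 (τ * s) * (s ^ 3)⁻¹) ^ 2 = min 1 (τ * s) ^ 2 * (s ^ 2)⁻¹ := by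
          field_simp
      _ ≤ 1 * (s ^ 2)⁻¹ := by gcongr
      _ = s ^ (-2 : ℝ) := by
        rw [one_mul, Real.rpow_neg hs0.le]; norm_cast
  have i1 : IntegrableOn h (Set.Ioc 0 τ⁻¹) :=
    Measure.integrableOn_of_bounded (by simp) hm.aestronglyMeasurable
      (ae_restrict_of_forall_mem measurableSet_Ioc h1)
  have i2' : IntegrableOn (fun s : ℝ ↦ s ^ (-2 : ℝ)) (Set.Ioi τ⁻¹) :=
    integrableOn_Ioi_rpow_of_lt (by norm_num) hτ'
  have i2 : IntegrableOn h (Set.Ioi τ⁻¹) :=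
    i2'.mono' hm.aestronglyMeasurable (ae_restrict_of_forall_mem measurableSet_Ioi h2)
  rw [← Set.Ioc_union_Ioi_eq_Ioi hτ'.le]
  refine ⟨i1.union i2, ?_⟩
  rw [setIntegral_union (Set.Ioc_disjoint_Ioi le_rfl) measurableSet_Ioi i1 i2]
  have b1 : ∫ s in Set.Ioc 0 τ⁻¹, h s ≤ τ := by
    refine (le_abs_self _).trans ((norm_setIntegral_le_of_norm_le_const (by simp) h1).trans
      (le_of_eq ?_))
    simp [hτ.le]
    field_simp
  have b2 : ∫ s in Set.Ioi τ⁻¹, h s ≤ τ := by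
    refine (le_abs_self _).trans ((norm_integral_le_of_norm_le i2'
      (ae_restrict_of_forall_mem measurableSet_Ioi h2)).trans (le_of_eq ?_))
    rw [integral_Ioi_rpow_of_lt (by norm_num) hτ']
    have : (-2 + 1 : ℝ) = -1 := by norm_num
    rw [this, Real.rpow_neg_one, inv_inv]
    ring
  linarith

theorem exists_integral_weight_sq_le : ∃ c : ℝ, 0 ≤ c ∧ ∀ τ : ℝ, 0 < τ →
    Integrable (fun z : E5 ↦ (min 1 (τ * ‖z‖) * (‖z‖ ^ 3)⁻¹) ^ 2) ∧
      ∫ z : E5, (min 1 (τ * ‖z‖) * (‖z‖ ^ 3)⁻¹) ^ 2 ≤ c * τ := by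
  refine ⟨5 * volume.real (Metric.ball (0 : E5) 1) * 2, by positivity, fun τ hτ ↦ ?_⟩
  have hfr : Module.finrank ℝ E5 = 5 := by simp [E5]
  obtain ⟨h1, h2⟩ := radial_weight_bound hτ
  refine ⟨?_, ?_⟩
  · rw [integrable_fun_norm_addHaar volume (f := fun s ↦ (min 1 (τ * s) * (s ^ 3)⁻¹) ^ 2), hfr]
    exact h1
  · rw [integral_fun_norm_addHaar volume (f := fun s ↦ (min 1 (τ * s) * (s ^ 3)⁻¹) ^ 2), hfr,
      nsmul_eq_mul, smul_eq_mul, mul_assoc, mul_assoc]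
    have : 0 ≤ volume.real (Metric.ball (0 : E5) 1) := by positivity
    push_cast
    gcongr

theorem integral_norm_sq_L2 (G : L2E5) : ∫ x, ‖G x‖ ^ 2 = ‖G‖ ^ 2 := by
  have h := L2.inner_def (𝕜 := ℂ) G G
  rw [inner_self_eq_norm_sq_to_K] at h
  have h2 : ∀ x, inner ℂ (G x) (G x) = ((‖G x‖ ^ 2 : ℝ) : ℂ) := fun x ↦ by
    rw [inner_self_eq_norm_sq_to_K]; simp
  simp only [h2] at h
  rw [integral_complex_ofReal] at h
  refine Complex.ofReal_injective (h.symm.trans ?_)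
  push_cast
  rfl

/-- Cauchy-Schwarz between the dilated `G` and the weight `min(1, τ|z|)|z|⁻³`, whose squared `L²`
norm is `O(τ)`. -/
theorem exists_weighted_L1_bound : ∃ C : ℝ, 0 ≤ C ∧
    ∀ (f : L2E5) (hf : MemSobolev 3 2 (hat f : 𝓢'(E5, ℂ))), Integrable f ∧
      ∀ τ : ℝ, 0 < τ → ∫ z, min 1 (τ * ‖z‖) * ‖f z‖ ≤
        C * τ ^ (1 / 2 : ℝ) * sobolevNorm 3 (hat f : 𝓢'(E5, ℂ)) hf := by
  obtain ⟨c, hc0, hc⟩ := exists_integral_weight_sq_le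
  have hr : (-(2 * Real.pi)⁻¹) ≠ 0 := neg_ne_zero.2 (by positivity)
  refine ⟨(2 * Real.pi) ^ 3 * ((2 * Real.pi) ^ 5) ^ (1 / 2 : ℝ) * c ^ (1 / 2 : ℝ),
    by positivity, fun f hf ↦ ?_⟩
  obtain ⟨G, hG, hGf⟩ := exists_weighted_L2_of_memSobolev f hf
  rw [← hG]
  set κ : ℝ := (2 * Real.pi) ^ (-(5 / 2 : ℝ)) with hκ
  have hκ0 : 0 ≤ κ := by positivity
  have hκ1 : κ ≤ 1 := Real.rpow_le_one_of_one_le_of_nonpos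
    (by linarith [Real.pi_gt_three]) (by norm_num)
  have hGd : MemLp (fun z : E5 ↦ G (-(2 * Real.pi)⁻¹ • z)) 2 := memLp_comp_smul hr (Lp.memLp G)
  have hGi : ∫ z : E5, ‖G (-(2 * Real.pi)⁻¹ • z)‖ ^ 2 = (2 * Real.pi) ^ 5 * ‖G‖ ^ 2 := by
    have h := Measure.integral_comp_smul (volume : Measure E5) (fun x ↦ ‖G x‖ ^ 2)
      (-(2 * Real.pi)⁻¹)
    have hfr : Module.finrank ℝ E5 = 5 := by simp [E5]
    have h5 : |((-(2 * Real.pi)⁻¹) ^ 5)⁻¹| = (2 * Real.pi) ^ 5 := by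
      rw [abs_inv, abs_pow, abs_neg, abs_of_pos (by positivity), inv_pow, inv_inv]
    rw [h, hfr, h5, smul_eq_mul, integral_norm_sq_L2]
  have hwt : ∀ z : E5, z ≠ 0 →
      (1 + ‖(-(2 * Real.pi)⁻¹ • z : E5)‖ ^ 2) ^ (-(3 / 2) : ℝ) ≤
        (2 * Real.pi) ^ 3 * (‖z‖ ^ 3)⁻¹ := by
    intro z hz
    have hz0 : 0 < ‖z‖ := norm_pos_iff.2 hz
    have hx : 0 < (2 * Real.pi)⁻¹ * ‖z‖ := by positivity
    rw [norm_smul, norm_neg, Real.norm_of_nonneg (by positivity)]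
    calc (1 + ((2 * Real.pi)⁻¹ * ‖z‖) ^ 2) ^ (-(3 / 2) : ℝ)
        ≤ (((2 * Real.pi)⁻¹ * ‖z‖) ^ 2) ^ (-(3 / 2) : ℝ) :=
          Real.rpow_le_rpow_of_nonpos (by positivity) (by linarith) (by norm_num)
      _ = ((2 * Real.pi)⁻¹ * ‖z‖) ^ (-3 : ℝ) := by
          rw [← Real.rpow_natCast, ← Real.rpow_mul hx.le]
          norm_num
      _ = (((2 * Real.pi)⁻¹ * ‖z‖) ^ 3)⁻¹ := by
          rw [Real.rpow_neg hx.le]; norm_cast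
      _ = _ := by
          rw [mul_pow, mul_inv, inv_pow, inv_inv]
  refine ⟨?_, fun τ hτ ↦ ?_⟩
  · have hW : MemLp (fun z : E5 ↦ (((1 + ‖z‖ ^ 2) ^ (-(3 / 2) : ℝ) : ℝ) : ℂ)) 2 := by
      have hcont : Continuous fun z : E5 ↦ (1 + ‖z‖ ^ 2) ^ (-(3 / 2) : ℝ) :=
        Continuous.rpow_const (by fun_prop) fun z ↦ Or.inl (by positivity)
      refine ((memLp_two_iff_integrable_sq hcont.aestronglyMeasurable).2 ?_).ofReal
      -- The cubic weight is square integrable because `6 > 5`; this is what puts `f` in `L¹`.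
      have := integrable_rpow_neg_one_add_norm_sq (E := E5) (μ := volume) (r := 6)
        (by simp [E5]; norm_num)
      refine this.congr (Filter.Eventually.of_forall fun z ↦ ?_)
      simp only
      rw [← Real.rpow_mul_natCast (by positivity)]
      norm_num
    have h1 := ((memLp_comp_smul hr hW).integrable_mul hGd).const_mul (κ : ℂ)
    refine h1.congr ?_
    filter_upwards [hGf] with z hz
    rw [hz]
    simp [mul_assoc]
  · have hcτ := hc τ hτ
    set w : E5 → ℝ := fun z ↦ min 1 (τ * ‖z‖) * (‖z‖ ^ 3)⁻¹ with hw
    have hw0 : ∀ z, 0 ≤ w z := fun z ↦ by simp only [hw]; positivity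
    have hwm : Measurable w := by simp only [hw]; fun_prop
    have hw2 : MemLp w 2 := (memLp_two_iff_integrable_sq hwm.aestronglyMeasurable).2 hcτ.1
    have hGn := hGd.norm
    have hprod : Integrable fun z : E5 ↦ ‖G (-(2 * Real.pi)⁻¹ • z)‖ * w z := hGn.integrable_mul hw2
    have hhold := integral_mul_le_Lp_mul_Lq_of_nonneg (μ := (volume : Measure E5))
      (f := fun z : E5 ↦ ‖G (-(2 * Real.pi)⁻¹ • z)‖) (g := w) (p := 2) (q := 2)
      Real.HolderConjugate.two_two (Filter.Eventually.of_forall fun z ↦ norm_nonneg _)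
      (Filter.Eventually.of_forall hw0) (by simpa using hGn) (by simpa using hw2)
    have hrp : ∀ x : ℝ, x ^ (2 : ℝ) = x ^ 2 := fun x ↦ Real.rpow_two x
    simp only [hrp] at hhold
    rw [hGi] at hhold
    have hae : ∀ᵐ z : E5, min 1 (τ * ‖z‖) * ‖f z‖ ≤
        (2 * Real.pi) ^ 3 * (‖G (-(2 * Real.pi)⁻¹ • z)‖ * w z) := by
      have h0 : ∀ᵐ z : E5, z ≠ 0 := by
        rw [ae_iff]; simp
      filter_upwards [hGf, h0] with z hz hz0
      rw [hz, norm_mul, norm_mul, Complex.norm_real, Complex.norm_real,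
        Real.norm_of_nonneg hκ0, Real.norm_of_nonneg (by positivity)]
      have hm0 : 0 ≤ min 1 (τ * ‖z‖) := by positivity
      calc min 1 (τ * ‖z‖) * (κ * (1 + ‖(-(2 * Real.pi)⁻¹ • z : E5)‖ ^ 2) ^ (-(3 / 2) : ℝ) *
            ‖G (-(2 * Real.pi)⁻¹ • z)‖)
          ≤ min 1 (τ * ‖z‖) * (1 * ((2 * Real.pi) ^ 3 * (‖z‖ ^ 3)⁻¹) *
            ‖G (-(2 * Real.pi)⁻¹ • z)‖) := by
            gcongr
            exact hwt z hz0
        _ = _ := by simp only [hw]; ring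
    calc ∫ z, min 1 (τ * ‖z‖) * ‖f z‖
        ≤ ∫ z : E5, (2 * Real.pi) ^ 3 * (‖G (-(2 * Real.pi)⁻¹ • z)‖ * w z) :=
          integral_mono_of_nonneg (Filter.Eventually.of_forall fun z ↦ by positivity)
            (hprod.const_mul _) hae
      _ ≤ (2 * Real.pi) ^ 3 * ((((2 * Real.pi) ^ 5 * ‖G‖ ^ 2) ^ (1 / 2 : ℝ)) *
            (c * τ) ^ (1 / 2 : ℝ)) := by
          rw [integral_const_mul]
          refine mul_le_mul_of_nonneg_left (hhold.trans ?_) (by positivity)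
          refine mul_le_mul_of_nonneg_left ?_ (by positivity)
          exact Real.rpow_le_rpow (integral_nonneg fun z ↦ by positivity) hcτ.2 (by norm_num)
      _ = _ := by
          rw [Real.mul_rpow (by positivity) (by positivity), Real.mul_rpow hc0 hτ.le,
            ← Real.rpow_natCast ‖G‖, ← Real.rpow_mul (norm_nonneg G)]
          norm_num
          ring

/-! ### Scaling in time and the propagator as a convolution. -/

/-- Substitute `ξ ↦ t^{1/4} ξ`; the Jacobian in dimension five is `t^{-5/4}`. -/
theorem quarticKernel_mul {t : ℝ} (ht : 0 < t) (a : ℂ) (y : E5) :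
    quarticKernel (t * a) y =
      ((t ^ (-(5 / 4) : ℝ) : ℝ) : ℂ) * quarticKernel a (t ^ (-(1 / 4) : ℝ) • y) := by
  have hR : 0 < t ^ (1 / 4 : ℝ) := by positivity
  have h := Measure.integral_comp_smul (volume : Measure E5)
    (fun ξ : E5 ↦ Complex.exp (Complex.I * ((inner ℝ (t ^ (-(1 / 4) : ℝ) • y) ξ : ℝ) : ℂ)) *
      quarticExp a ‖ξ‖) (t ^ (1 / 4 : ℝ))
  have hfr : Module.finrank ℝ E5 = 5 := by simp [E5]
  have h5 : |((t ^ (1 / 4 : ℝ)) ^ 5)⁻¹| = t ^ (-(5 / 4) : ℝ) := by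
    rw [abs_of_pos (by positivity), ← Real.rpow_mul_natCast ht.le, ← Real.rpow_neg ht.le]
    norm_num
  rw [hfr, h5, Complex.real_smul] at h
  rw [quarticKernel, quarticKernel, ← h]
  congr 1
  ext ξ
  have h1 : inner ℝ (t ^ (-(1 / 4) : ℝ) • y) (t ^ (1 / 4 : ℝ) • ξ) = inner ℝ y ξ := by
    rw [real_inner_smul_left, real_inner_smul_right, ← mul_assoc, ← Real.rpow_add ht]
    norm_num
  have h2 : quarticExp (t * a) ‖ξ‖ = quarticExp a ‖t ^ (1 / 4 : ℝ) • ξ‖ := by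
    have h4 : (t ^ (1 / 4 : ℝ)) ^ 4 = t := by
      rw [← Real.rpow_mul_natCast ht.le]
      norm_num
    rw [quarticExp, quarticExp, norm_smul, Real.norm_of_nonneg hR.le, mul_pow, h4]
    push_cast
    ring_nf
  rw [h1, h2]

theorem integrable_quarticExp_two_pi {b : ℂ} (hb : 0 < b.re) :
    Integrable fun η : E5 ↦ quarticExp b (2 * Real.pi * ‖η‖) := by
  have h := (integrable_quarticExp_norm hb).comp_smul (R := 2 * Real.pi) (by positivity)
  refine h.congr (Filter.Eventually.of_forall fun η ↦ ?_)
  simp only [norm_smul, Real.norm_of_nonneg (by positivity : 0 ≤ 2 * Real.pi)]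

theorem integral_exp_quarticExp_two_pi (b : ℂ) (y : E5) :
    ∫ η : E5, Complex.exp (((2 * Real.pi * inner ℝ η y : ℝ) : ℂ) * Complex.I) *
      quarticExp b (2 * Real.pi * ‖η‖) =
      ((((2 * Real.pi) ^ 5)⁻¹ : ℝ) : ℂ) * quarticKernel b y := by
  have h := Measure.integral_comp_smul (volume : Measure E5)
    (fun ξ : E5 ↦ Complex.exp (Complex.I * ((inner ℝ y ξ : ℝ) : ℂ)) * quarticExp b ‖ξ‖)
    (2 * Real.pi)
  have hfr : Module.finrank ℝ E5 = 5 := by simp [E5]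
  rw [hfr, abs_of_pos (by positivity), Complex.real_smul] at h
  rw [quarticKernel, ← h]
  congr 1
  ext η
  rw [norm_smul, Real.norm_of_nonneg (by positivity : 0 ≤ 2 * Real.pi), real_inner_smul_right,
    real_inner_comm, mul_comm Complex.I]

theorem exists_norm_fourier_le {f : E5 → ℂ} : ∃ C : ℝ, ∀ η, ‖𝓕 f η‖ ≤ C :=
  ⟨∫ x, ‖f x‖, fun η ↦ VectorFourier.norm_fourierIntegral_le_integral_norm _ _ _ _ η⟩

theorem integrable_quarticExp_mul_fourier {b : ℂ} (hb : 0 < b.re) {f : E5 → ℂ}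
    (hf : Integrable f) :
    Integrable fun η : E5 ↦ quarticExp b (2 * Real.pi * ‖η‖) * 𝓕 f η := by
  obtain ⟨C, hC⟩ := exists_norm_fourier_le (f := f)
  exact (integrable_quarticExp_two_pi hb).mul_bdd (c := C)
    (continuous_fourier_of_integrable hf).aestronglyMeasurable (Filter.Eventually.of_forall hC)

/-- The regularized propagator is a convolution operator. -/
theorem fourierInv_quarticExp_mul_fourier {b : ℂ} (hb : 0 < b.re) {f : E5 → ℂ}
    (hf : Integrable f) (x : E5) :
    𝓕⁻ (fun η : E5 ↦ quarticExp b (2 * Real.pi * ‖η‖) * 𝓕 f η) x =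
      ∫ z, ((((2 * Real.pi) ^ 5)⁻¹ : ℝ) : ℂ) * quarticKernel b (x - z) * f z := by
  set q : E5 → ℂ := fun η ↦ Complex.exp (((2 * Real.pi * inner ℝ η x : ℝ) : ℂ) * Complex.I) *
    quarticExp b (2 * Real.pi * ‖η‖) with hq
  have hqi : Integrable q := by
    refine (integrable_quarticExp_two_pi hb).bdd_mul (c := 1)
      (Continuous.aestronglyMeasurable (by fun_prop)) (Filter.Eventually.of_forall fun η ↦ ?_)
    rw [Complex.norm_exp_ofReal_mul_I]
  have h1 : 𝓕⁻ (fun η : E5 ↦ quarticExp b (2 * Real.pi * ‖η‖) * 𝓕 f η) x =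
      ∫ η, q η * 𝓕 f η := by
    rw [Real.fourierInv_eq']
    congr 1
    ext η
    rw [smul_eq_mul, ← mul_assoc (Complex.exp _)]
  -- The multiplication formula moves the transform from `f` to `q`, whose transform at `z` is the
  -- kernel at `x - z`.
  rw [h1, ← integral_fourier_mul_eq_mul_fourier hqi hf]
  congr 1
  ext z
  rw [← integral_exp_quarticExp_two_pi, Real.fourier_eq']
  congr 2
  ext η
  simp only [hq]
  rw [smul_eq_mul, ← mul_assoc, ← Complex.exp_add, inner_sub_right]
  congr 2
  push_cast
  ring

/-- The kernel at time `t` obtained from the kernel at time `1` by scaling. -/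
noncomputable def scaledKernel (K : E5 → ℂ) (t : ℝ) (x : E5) : ℂ :=
  ((t ^ (-(5 / 4) : ℝ) : ℝ) : ℂ) * K (t ^ (-(1 / 4) : ℝ) • x)

/-- Convolution with the kernel at time `t`. -/
noncomputable def kernelSolution (K : E5 → ℂ) (t : ℝ) (f : E5 → ℂ) (x : E5) : ℂ :=
  ∫ z, ((((2 * Real.pi) ^ 5)⁻¹ : ℝ) : ℂ) * scaledKernel K t (x - z) * f z

namespace KernelBounds

variable {C : ℝ} {K : E5 → ℂ}

theorem nonneg (h : KernelBounds C K) : 0 ≤ C := (norm_nonneg _).trans (h.bound 0)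

theorem continuous (h : KernelBounds C K) : Continuous K := by
  have : LipschitzWith C.toNNReal K := LipschitzWith.of_dist_le_mul fun y z ↦ by
    rw [dist_eq_norm, dist_eq_norm, Real.coe_toNNReal _ h.nonneg]
    exact h.lipschitz y z
  exact this.continuous

theorem norm_scaledKernel_le (h : KernelBounds C K) {t : ℝ} (ht : 0 < t) (x : E5) :
    ‖scaledKernel K t x‖ ≤ C * t ^ (-(5 / 4) : ℝ) := by
  rw [scaledKernel, norm_mul, Complex.norm_real, Real.norm_of_nonneg (by positivity), mul_comm]
  exact mul_le_mul_of_nonneg_right (h.bound _) (by positivity)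

theorem continuous_scaledKernel (h : KernelBounds C K) (t : ℝ) : Continuous (scaledKernel K t) :=
  continuous_const.mul (h.continuous.comp (continuous_const_smul _))

theorem integrable_scaledKernel_mul (h : KernelBounds C K) {t : ℝ} (ht : 0 < t) {f : E5 → ℂ}
    (hf : Integrable f) (x : E5) : Integrable fun z ↦ scaledKernel K t (x - z) * f z :=
  hf.bdd_mul ((h.continuous_scaledKernel t).comp (by fun_prop)).aestronglyMeasurable
    (Filter.Eventually.of_forall fun z ↦ h.norm_scaledKernel_le ht (x - z))

theorem continuous_kernelSolution (h : KernelBounds C K) {t : ℝ} (ht : 0 < t) {f : E5 → ℂ}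
    (hf : Integrable f) : Continuous (kernelSolution K t f) := by
  have hc := h.continuous_scaledKernel t
  refine continuous_of_dominated
    (bound := fun z ↦ ((2 * Real.pi) ^ 5)⁻¹ * (C * t ^ (-(5 / 4) : ℝ)) * ‖f z‖)
    (fun x ↦ ?_) (fun x ↦ Filter.Eventually.of_forall fun z ↦ ?_) (hf.norm.const_mul _)
    (Filter.Eventually.of_forall fun z ↦ by fun_prop)
  · exact (Continuous.aestronglyMeasurable (by fun_prop)).mul hf.aestronglyMeasurable
  · rw [norm_mul, norm_mul, Complex.norm_real, Real.norm_of_nonneg (by positivity)]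
    gcongr
    exact h.norm_scaledKernel_le ht _

end KernelBounds

/-- The form `0 - I` displays the symbol as the value at `ε = 0` of the regularized symbols. -/
theorem propagatorSymbol_eq (t : ℝ) (η : E5) :
    propagatorSymbol t η = quarticExp (t * (0 - Complex.I)) (2 * Real.pi * ‖η‖) := by
  rw [propagatorSymbol, quarticExp]
  congr 1
  push_cast
  ring

/-- `e^{itΔ²} f` is the convolution of `f` with the limit kernel, for `f ∈ L¹ ∩ L²`. -/
theorem kernelSolution_ae_eq_propagator {C : ℝ} {K : E5 → ℂ} {ε : ℕ → ℝ}
    (hK : KernelBounds C K) (hε : ∀ n, 0 < ε n) (hε0 : Filter.Tendsto ε Filter.atTop (nhds 0))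
    (hb : ∀ n y, ‖quarticKernel (ε n - Complex.I) y‖ ≤ C)
    (hlim : ∀ y, Filter.Tendsto (fun n ↦ quarticKernel (ε n - Complex.I) y) Filter.atTop
      (nhds (K y))) {f : L2E5} (hf : Integrable f) {t : ℝ} (ht : 0 < t) :
    kernelSolution K t f =ᵐ[volume] propagator t f := by
  refine ae_eq_of_integral_schwartz_mul (hK.continuous_kernelSolution ht hf).locallyIntegrable
    (locallyIntegrable_L2 _) fun φ ↦ ?_
  have hbn : ∀ n, 0 < ((t : ℂ) * ((ε n : ℂ) - Complex.I)).re := by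
    intro n
    rw [Complex.re_ofReal_mul, Complex.sub_re, Complex.I_re, Complex.ofReal_re, sub_zero]
    exact mul_pos ht (hε n)
  set A : ℕ → E5 → ℂ := fun n η ↦
    quarticExp (t * (ε n - Complex.I)) (2 * Real.pi * ‖η‖) * 𝓕 (f : E5 → ℂ) η with hA
  have hAi : ∀ n, Integrable (A n) := fun n ↦ integrable_quarticExp_mul_fourier (hbn n) hf
  have hAx : ∀ n x, 𝓕⁻ (A n) x = ∫ z, ((((2 * Real.pi) ^ 5)⁻¹ : ℝ) : ℂ) *
      scaledKernel (quarticKernel (ε n - Complex.I)) t (x - z) * f z := by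
    intro n x
    rw [hA, fourierInv_quarticExp_mul_fourier (hbn n) hf]
    congr 1
    ext z
    rw [quarticKernel_mul ht, scaledKernel]
  have hsk : ∀ n x, ‖scaledKernel (quarticKernel (ε n - Complex.I)) t x‖ ≤
      C * t ^ (-(5 / 4) : ℝ) := by
    intro n x
    rw [scaledKernel, norm_mul, Complex.norm_real, Real.norm_of_nonneg (by positivity), mul_comm]
    exact mul_le_mul_of_nonneg_right (hb n _) (by positivity)
  set M : ℝ := ((2 * Real.pi) ^ 5)⁻¹ * (C * t ^ (-(5 / 4) : ℝ)) with hM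
  have hkn : ∀ n x z, ‖((((2 * Real.pi) ^ 5)⁻¹ : ℝ) : ℂ) *
      scaledKernel (quarticKernel (ε n - Complex.I)) t (x - z) * f z‖ ≤ M * ‖f z‖ := by
    intro n x z
    rw [norm_mul, norm_mul, Complex.norm_real, Real.norm_of_nonneg (by positivity)]
    exact mul_le_mul_of_nonneg_right (mul_le_mul_of_nonneg_left (hsk n _) (by positivity))
      (norm_nonneg _)
  have hqc : ∀ n, Continuous (quarticKernel (ε n - Complex.I)) := by
    intro n
    have h1 : quarticKernel ((ε n : ℂ) - Complex.I) = fun y ↦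
        (((2 * Real.pi) ^ 5 : ℝ) : ℂ) *
          𝓕⁻ (fun η : E5 ↦ quarticExp (ε n - Complex.I) (2 * Real.pi * ‖η‖)) y := by
      ext y
      rw [Real.fourierInv_eq']
      simp only [smul_eq_mul]
      rw [integral_exp_quarticExp_two_pi, ← mul_assoc, ← Complex.ofReal_mul,
        mul_inv_cancel₀ (by positivity), Complex.ofReal_one, one_mul]
    rw [h1, Real.fourierInv_eq_fourier_comp_neg]
    refine continuous_const.mul (continuous_fourier_of_integrable
      (Integrable.comp_neg (integrable_quarticExp_two_pi ?_)))
    rw [Complex.sub_re, Complex.I_re, Complex.ofReal_re, sub_zero]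
    exact hε n
  -- the physical side
  have hpt : ∀ x, Filter.Tendsto (fun n ↦ 𝓕⁻ (A n) x) Filter.atTop
      (nhds (kernelSolution K t f x)) := by
    intro x
    simp only [hAx, kernelSolution]
    refine tendsto_integral_of_dominated_convergence (fun z ↦ M * ‖f z‖) (fun n ↦ ?_)
      (hf.norm.const_mul M) (fun n ↦ Filter.Eventually.of_forall (hkn n x))
      (Filter.Eventually.of_forall fun z ↦ ?_)
    · refine AEStronglyMeasurable.mul (Continuous.aestronglyMeasurable ?_) hf.aestronglyMeasurable
      have := hqc n
      unfold scaledKernel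
      fun_prop
    · exact (((hlim _).const_mul _).const_mul _).mul_const _
  have hphys : Filter.Tendsto (fun n ↦ ∫ x, φ x * 𝓕⁻ (A n) x) Filter.atTop
      (nhds (∫ x, φ x * kernelSolution K t f x)) := by
    refine tendsto_integral_of_dominated_convergence (fun x ↦ ‖φ x‖ * ∫ z, M * ‖f z‖)
      (fun n ↦ ?_) (φ.integrable.norm.mul_const _)
      (fun n ↦ Filter.Eventually.of_forall fun x ↦ ?_)
      (Filter.Eventually.of_forall fun x ↦ (hpt x).const_mul _)
    · have hc : Continuous (𝓕⁻ (A n)) := by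
        rw [Real.fourierInv_eq_fourier_comp_neg]
        exact continuous_fourier_of_integrable (hAi n).comp_neg
      exact (φ.continuous.mul hc).aestronglyMeasurable
    · rw [norm_mul, hAx]
      exact mul_le_mul_of_nonneg_left (norm_integral_le_of_norm_le (hf.norm.const_mul M)
        (Filter.Eventually.of_forall (hkn n x))) (norm_nonneg _)
  -- the Fourier side
  obtain ⟨B, hB⟩ := exists_norm_fourier_le (f := (f : E5 → ℂ))
  have hfour : Filter.Tendsto (fun n ↦ ∫ η, (𝓕⁻ φ : 𝓢(E5, ℂ)) η * A n η) Filter.atTop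
      (nhds (∫ η, (𝓕⁻ φ : 𝓢(E5, ℂ)) η * (propagatorSymbol t η * 𝓕 (f : E5 → ℂ) η))) := by
    refine tendsto_integral_of_dominated_convergence (fun η ↦ ‖(𝓕⁻ φ : 𝓢(E5, ℂ)) η‖ * B)
      (fun n ↦ ((𝓕⁻ φ : 𝓢(E5, ℂ)).continuous.aestronglyMeasurable.mul
        (hAi n).aestronglyMeasurable)) ((𝓕⁻ φ : 𝓢(E5, ℂ)).integrable.norm.mul_const _)
      (fun n ↦ Filter.Eventually.of_forall fun η ↦ ?_)
      (Filter.Eventually.of_forall fun η ↦ ?_)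
    · rw [norm_mul, hA, norm_mul]
      refine mul_le_mul_of_nonneg_left ?_ (norm_nonneg _)
      exact (mul_le_of_le_one_left (norm_nonneg _)
        (norm_quarticExp_le_one (hbn n).le _)).trans (hB η)
    · refine Filter.Tendsto.const_mul _ (Filter.Tendsto.mul_const _ ?_)
      rw [propagatorSymbol_eq]
      have hcont : Continuous fun e : ℝ ↦
          quarticExp (t * (e - Complex.I)) (2 * Real.pi * ‖η‖) := by
        unfold quarticExp
        fun_prop
      have := (hcont.tendsto 0).comp hε0
      simpa using! this
  have hflip : ∀ n, ∫ η, (𝓕⁻ φ : 𝓢(E5, ℂ)) η * A n η = ∫ x, φ x * 𝓕⁻ (A n) x := fun n ↦ by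
    rw [SchwartzMap.fourierInv_coe]
    exact integral_fourierInv_mul_eq_mul_fourierInv φ.integrable (hAi n)
  simp only [hflip] at hfour
  -- The regularized pairings coincide for each `n`, so their physical-side and Fourier-side limits
  -- coincide.
  rw [tendsto_nhds_unique hphys hfour, propagator, integral_schwartz_mul_fourierInv_L2]
  refine integral_congr_ae ?_
  filter_upwards [(memLp_propagatorSymbol_mul t (𝓕 f)).coeFn_toLp, fourier_L2_ae_eq hf]
    with η h1 h2
  rw [h1, h2]

/-! ### Comparison with the critical point and the final estimate. -/

theorem norm_xiStar_le {t : ℝ} (ht : 0 < t) (x : E5) :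
    ‖xiStar x t‖ ≤ ‖(t ^ (-(1 / 4) : ℝ) • x : E5)‖ ^ (1 / 3 : ℝ) * t ^ (-(1 / 4) : ℝ) := by
  have h1 : ‖(‖x‖⁻¹ • x : E5)‖ ≤ 1 := by
    rw [norm_smul, norm_inv, norm_norm]
    exact inv_mul_le_one
  have h2 : (t ^ (-(3 / 4) : ℝ)) ^ (1 / 3 : ℝ) = t ^ (-(1 / 4) : ℝ) := by
    rw [← Real.rpow_mul ht.le]
    norm_num
  have h3 : t ^ (-(1 / 4) : ℝ) * t ^ (-(3 / 4) : ℝ) = t⁻¹ := by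
    rw [← Real.rpow_add ht, ← Real.rpow_neg_one]
    norm_num
  rw [xiStar, norm_smul, norm_neg, Real.norm_of_nonneg (by positivity)]
  refine (mul_le_of_le_one_right (by positivity) h1).trans ?_
  rw [norm_smul, Real.norm_of_nonneg (by positivity), ← h2,
    ← Real.mul_rpow (by positivity) (by positivity), mul_right_comm, h2, h3]
  refine Real.rpow_le_rpow (by positivity) ?_ (by norm_num)
  rw [inv_mul_eq_div]
  gcongr
  linarith

/-- The phase `e^{-iz·ξ_*}` is only compared with `1`: the size of `ξ_*` matters, and the growth
`‖y‖^{1/3}` in `norm_xiStar_le` is exactly what the decay of `K` absorbs. -/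
theorem KernelBounds.norm_scaledKernel_sub_le {C : ℝ} {K : E5 → ℂ} (h : KernelBounds C K) {t : ℝ}
    (ht : 0 < t) (x z : E5) :
    ‖scaledKernel K t (x - z) - scaledKernel K t x *
      Complex.exp (Complex.I * ((-inner ℝ z (xiStar x t) : ℝ) : ℂ))‖ ≤
      2 * C * t ^ (-(5 / 4) : ℝ) * min 1 (t ^ (-(1 / 4) : ℝ) * ‖z‖) := by
  have hC := h.nonneg
  set T : ℝ := t ^ (-(5 / 4) : ℝ) with hT
  set s : ℝ := t ^ (-(1 / 4) : ℝ) with hs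
  have hT0 : 0 ≤ T := by positivity
  have hs0 : 0 ≤ s := by positivity
  rw [mul_min_of_nonneg _ _ (by positivity)]
  refine le_min ?_ ?_
  · refine (norm_sub_le _ _).trans ?_
    rw [norm_mul, norm_exp_I_mul_ofReal, mul_one]
    have h1 := h.norm_scaledKernel_le ht (x - z)
    have h2 := h.norm_scaledKernel_le ht x
    linarith
  · have h1 : ‖scaledKernel K t (x - z) - scaledKernel K t x‖ ≤ C * T * (s * ‖z‖) := by
      rw [scaledKernel, scaledKernel, ← mul_sub, norm_mul, Complex.norm_real,
        Real.norm_of_nonneg (by positivity)]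
      have h2 := h.lipschitz (s • (x - z)) (s • x)
      have h3 : ‖s • (x - z) - s • x‖ = s * ‖z‖ := by
        rw [← smul_sub, norm_smul, Real.norm_of_nonneg hs0]
        simp
      rw [h3] at h2
      calc T * _ ≤ T * (C * (s * ‖z‖)) := mul_le_mul_of_nonneg_left h2 hT0
        _ = _ := by ring
    have h4 : ‖scaledKernel K t x *
        (Complex.exp (Complex.I * ((-inner ℝ z (xiStar x t) : ℝ) : ℂ)) - 1)‖ ≤
        C * T * (s * ‖z‖) := by
      rw [norm_mul, scaledKernel, norm_mul, Complex.norm_real,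
        Real.norm_of_nonneg (by positivity)]
      have h5 := Real.norm_exp_I_mul_ofReal_sub_one_le (x := -inner ℝ z (xiStar x t))
      have h6 : ‖-inner ℝ z (xiStar x t)‖ ≤ ‖z‖ * ‖xiStar x t‖ := by
        rw [norm_neg]; exact norm_inner_le_norm z _
      have h7 := norm_xiStar_le ht x
      calc T * ‖K (s • x)‖ * _ ≤ T * ‖K (s • x)‖ * (‖z‖ * (‖s • x‖ ^ (1 / 3 : ℝ) * s)) := by
            gcongr
            exact h5.trans (h6.trans (by gcongr))
        _ = T * (‖s • x‖ ^ (1 / 3 : ℝ) * ‖K (s • x)‖) * (s * ‖z‖) := by ring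
        _ ≤ T * C * (s * ‖z‖) := by
            gcongr
            exact h.decay _
        _ = _ := by ring
    have h8 : scaledKernel K t (x - z) - scaledKernel K t x *
        Complex.exp (Complex.I * ((-inner ℝ z (xiStar x t) : ℝ) : ℂ)) =
        (scaledKernel K t (x - z) - scaledKernel K t x) - scaledKernel K t x *
        (Complex.exp (Complex.I * ((-inner ℝ z (xiStar x t) : ℝ) : ℂ)) - 1) := by ring
    rw [h8]
    refine (norm_sub_le _ _).trans ?_
    linarith

/-- The set where a continuous function exceeds its essential supremum is open and null, hence
empty. This bounds `fhat` at the individual points `ξ_*`. -/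
theorem enorm_le_eLpNorm_top_of_continuous {g : E5 → ℂ} (hg : Continuous g) (x : E5) :
    ‖g x‖ₑ ≤ eLpNorm g ∞ volume := by
  have hopen : IsOpen {y | eLpNorm g ∞ volume < ‖g y‖ₑ} := isOpen_lt continuous_const hg.enorm
  have h0 : volume {y | eLpNorm g ∞ volume < ‖g y‖ₑ} = 0 := by
    rw [eLpNorm_exponent_top]
    simpa [ae_iff] using enorm_ae_le_eLpNormEssSup g (volume : Measure E5)
  have he := hopen.measure_eq_zero_iff (μ := (volume : Measure E5)) |>.1 h0
  by_contra hx
  have : x ∈ {y | eLpNorm g ∞ volume < ‖g y‖ₑ} := not_le.1 hx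
  rw [he] at this
  exact this

theorem lemma4p1 :
    ∃ (C : ℝ) (ρ : E5 → ℝ → ℂ),
      (∀ t : ℝ, 0 < t → ∀ x : E5, ‖ρ x t‖ ≤ C * t ^ (-(5 / 4) : ℝ)) ∧
      ∀ (f : L2E5) (hf : MemSobolev 3 2 (hat f : 𝓢'(E5, ℂ))),
        -- `fhat` is the continuous representative of the Fourier transform of `f`
        ∃ fhat : E5 → ℂ, Continuous fhat ∧ fhat =ᵐ[volume] hat f ∧
          ∀ t : ℝ, 0 < t →
            -- `u` is the continuous representative of the solution at time `t`
            (∃ u : E5 → ℂ, Continuous u ∧ u =ᵐ[volume] propagator t f ∧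
              ∀ x : E5, ‖u x - ρ x t * fhat (xiStar x t)‖ ≤
                C * t ^ (-(11 / 8) : ℝ) * sobolevNorm 3 (hat f : 𝓢'(E5, ℂ)) hf) ∧
            eLpNorm (propagator t f) ∞ volume ≤
              ENNReal.ofReal (C * t ^ (-(5 / 4) : ℝ)) * eLpNorm (hat f) ∞ volume +
              ENNReal.ofReal
                (C * t ^ (-(11 / 8) : ℝ) * sobolevNorm 3 (hat f : 𝓢'(E5, ℂ)) hf) := by
  obtain ⟨C₀, K, ε, hC₀, hK, hε, hε0, hb, hlim⟩ := exists_limit_quarticKernel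
  obtain ⟨C₁, hC₁, hw⟩ := exists_weighted_L1_bound
  set κ : ℝ := (2 * Real.pi) ^ (-(5 / 2 : ℝ)) with hκ
  have hκ0 : 0 ≤ κ := by positivity
  have hκ1 : κ ≤ 1 := Real.rpow_le_one_of_one_le_of_nonpos
    (by linarith [Real.pi_gt_three]) (by norm_num)
  have hκκ : κ * κ = ((2 * Real.pi) ^ 5)⁻¹ := by
    rw [hκ, ← Real.rpow_add (by positivity), ← Real.rpow_natCast, ← Real.rpow_neg (by positivity)]
    norm_num
  have hρ : ∀ t : ℝ, 0 < t → ∀ x : E5,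
      ‖(κ : ℂ) * scaledKernel K t x‖ ≤ (C₀ + 2 * C₀ * C₁) * t ^ (-(5 / 4) : ℝ) := by
    intro t ht x
    rw [norm_mul, Complex.norm_real, Real.norm_of_nonneg hκ0]
    refine (mul_le_of_le_one_left (norm_nonneg _) hκ1).trans
      ((hK.norm_scaledKernel_le ht x).trans ?_)
    gcongr
    have : 0 ≤ C₀ * C₁ := by positivity
    linarith
  -- One `κ` sits in `ρ` and the other in `fourierRep`; together they give the factor `(2π)^{-5}` of
  -- the convolution. In the constant, `C₀` covers `ρ` and `2 * C₀ * C₁` the remainder.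
  refine ⟨C₀ + 2 * C₀ * C₁, fun x t ↦ κ * scaledKernel K t x, hρ, fun f hf ↦ ?_⟩
  obtain ⟨hfi, hfw⟩ := hw f hf
  have hN : 0 ≤ sobolevNorm 3 (hat f : 𝓢'(E5, ℂ)) hf := norm_nonneg _
  have hcont : Continuous (fourierRep f) := continuous_fourierRep hfi
  refine ⟨fourierRep f, hcont, fourierRep_ae_eq_hat hfi, fun t ht ↦ ?_⟩
  have hu := kernelSolution_ae_eq_propagator hK hε hε0 hb hlim hfi ht
  have hmain : ∀ x, ‖kernelSolution K t f x - κ * scaledKernel K t x *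
      fourierRep f (xiStar x t)‖ ≤ (C₀ + 2 * C₀ * C₁) * t ^ (-(11 / 8) : ℝ) *
        sobolevNorm 3 (hat f : 𝓢'(E5, ℂ)) hf := by
    intro x
    have hei : Integrable fun z ↦
        Complex.exp (Complex.I * ((-inner ℝ z (xiStar x t) : ℝ) : ℂ)) * f z :=
      hfi.bdd_mul (c := 1) (Continuous.aestronglyMeasurable (by fun_prop))
        (Filter.Eventually.of_forall fun z ↦ (norm_exp_I_mul_ofReal _).le)
    have hdiff : kernelSolution K t f x - κ * scaledKernel K t x * fourierRep f (xiStar x t) =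
        ((κ * κ : ℝ) : ℂ) * ∫ z, (scaledKernel K t (x - z) - scaledKernel K t x *
          Complex.exp (Complex.I * ((-inner ℝ z (xiStar x t) : ℝ) : ℂ))) * f z := by
      have e1 : ∀ z, (scaledKernel K t (x - z) - scaledKernel K t x *
          Complex.exp (Complex.I * ((-inner ℝ z (xiStar x t) : ℝ) : ℂ))) * f z =
          scaledKernel K t (x - z) * f z - scaledKernel K t x *
          (Complex.exp (Complex.I * ((-inner ℝ z (xiStar x t) : ℝ) : ℂ)) * f z) :=
        fun z ↦ by ring
      simp only [e1]
      rw [integral_sub (hK.integrable_scaledKernel_mul ht hfi x) (hei.const_mul _),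
        integral_const_mul, kernelSolution, fourierRep, ← hκκ]
      simp only [mul_assoc]
      rw [integral_const_mul]
      push_cast
      ring
    have hmint : Integrable fun z : E5 ↦ min 1 (t ^ (-(1 / 4) : ℝ) * ‖z‖) * ‖f z‖ := by
      refine hfi.norm.bdd_mul (c := 1) (Continuous.aestronglyMeasurable (by fun_prop))
        (Filter.Eventually.of_forall fun z ↦ ?_)
      rw [Real.norm_of_nonneg (by positivity)]
      exact min_le_left _ _
    have hint : ‖∫ z, (scaledKernel K t (x - z) - scaledKernel K t x *
        Complex.exp (Complex.I * ((-inner ℝ z (xiStar x t) : ℝ) : ℂ))) * f z‖ ≤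
        2 * C₀ * t ^ (-(5 / 4) : ℝ) * ∫ z, min 1 (t ^ (-(1 / 4) : ℝ) * ‖z‖) * ‖f z‖ := by
      rw [← integral_const_mul]
      refine norm_integral_le_of_norm_le (hmint.const_mul _)
        (Filter.Eventually.of_forall fun z ↦ ?_)
      rw [norm_mul, ← mul_assoc]
      exact mul_le_mul_of_nonneg_right (hK.norm_scaledKernel_sub_le ht x z) (norm_nonneg _)
    have hτ := hfw (t ^ (-(1 / 4) : ℝ)) (by positivity)
    -- The square root of `τ = t^{-1/4}` accounts for the gain `5/4 + 1/8 = 11/8`.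
    have hpow : t ^ (-(5 / 4) : ℝ) * (t ^ (-(1 / 4) : ℝ)) ^ (1 / 2 : ℝ) = t ^ (-(11 / 8) : ℝ) := by
      rw [← Real.rpow_mul ht.le, ← Real.rpow_add ht]
      norm_num
    rw [hdiff, norm_mul, Complex.norm_real, Real.norm_of_nonneg (by positivity)]
    refine (mul_le_of_le_one_left (norm_nonneg _) (mul_le_one₀ hκ1 hκ0 hκ1)).trans
      (hint.trans ?_)
    calc 2 * C₀ * t ^ (-(5 / 4) : ℝ) * ∫ z, min 1 (t ^ (-(1 / 4) : ℝ) * ‖z‖) * ‖f z‖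
        ≤ 2 * C₀ * t ^ (-(5 / 4) : ℝ) * (C₁ * (t ^ (-(1 / 4) : ℝ)) ^ (1 / 2 : ℝ) *
          sobolevNorm 3 (hat f : 𝓢'(E5, ℂ)) hf) := by gcongr
      _ = 2 * C₀ * C₁ * (t ^ (-(5 / 4) : ℝ) * (t ^ (-(1 / 4) : ℝ)) ^ (1 / 2 : ℝ)) *
          sobolevNorm 3 (hat f : 𝓢'(E5, ℂ)) hf := by ring
      _ ≤ _ := by
        rw [hpow]
        gcongr
        linarith
  refine ⟨⟨kernelSolution K t f, hK.continuous_kernelSolution ht hfi, hu, hmain⟩, ?_⟩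
  rw [← eLpNorm_congr_ae hu, ← eLpNorm_congr_ae (fourierRep_ae_eq_hat hfi),
    eLpNorm_exponent_top (f := kernelSolution K t f)]
  refine eLpNormEssSup_le_of_ae_enorm_bound (Filter.Eventually.of_forall fun x ↦ ?_)
  have hsplit : kernelSolution K t f x = κ * scaledKernel K t x * fourierRep f (xiStar x t) +
      (kernelSolution K t f x - κ * scaledKernel K t x * fourierRep f (xiStar x t)) := by ring
  rw [hsplit]
  refine (enorm_add_le _ _).trans (add_le_add ?_ ?_)
  · rw [enorm_mul]
    refine mul_le_mul' ?_ (enorm_le_eLpNorm_top_of_continuous hcont _)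
    rw [← ofReal_norm]
    exact ENNReal.ofReal_le_ofReal (hρ t ht x)
  · rw [← ofReal_norm]
    exact ENNReal.ofReal_le_ofReal (hmain x)
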